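/- Let $1<k<n$. Let $M$ be an $n$-dimensional manifold (without boundary) and $X:M\to\mathbb R^{n+1}$ a $C^4$ immersion with outer unit normal $\nu$ whose support function $u=\langle X,\nu\rangle$ is positive on $M$ (for instance a closed hypersurface that is star-shaped with respect to the origin). Let $g_{ij}=\langle \partial_iX,\partial_jX\rangle$ be the induced metric, $h_{ij}=\langle\partial_iX,\partial_j\nu\rangle$ the second fundamental form $A$, and $\kappa=(\kappa_1,\dots,\kappa_n)$ the principal curvatures, i.e. the roots of $\det(h_{ij}-\kappa g_{ij})=0$. Put $F=\sigma_k(\kappa)$ and $H=\sigma_1(\kappa)$, where $\sigma_m$ is the $m$-th elementary symmetric function, and write $F=\phi u$ with $\phi:M\to\mathbb R$. Then at every point where $H/u$ has a (local) maximum, $$ F^{ij}\Bigl(\frac Hu\Bigr)_{ij}=\frac1u\bigl[\phi_{ss}u+2\phi_su_s\bigr]-\frac Hu\,\phi_l\langle X,X_l\rangle-(k-1)\frac Hu\,\phi+(k-1)\phi|A|^2-\frac1uF^{ij;ml}h_{ij;s}h_{ml;s}. $$ Here $F^{ij}=\partial F/\partial h_{ij}$ and $F^{ij;ml}=\partial^2F/\partial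 h_{ij}\partial h_{ml}$, where $F=\sigma_k(g^{-1}h)$ is regarded as a function of the matrix $(h_{ij})$ with $g$ fixed; lower indices on functions, and indices after a semicolon on $h$, denote covariant derivatives with respect to $g$; and repeated indices are summed over an orthonormal frame at the point (equivalently, in arbitrary local coordinates, repeated lower indices are contracted with $g^{-1}$). -/

import Mathlib

open scoped Manifold ContDiff RealInnerProductSpace

noncomputable section

namespace PrescribedCurvature

/-- Euclidean space of dimension `m`. -/
abbrev E (m : ℕ) : Type := EuclideanSpace ℝ (Fin m)

/-- `k`-th elementary symmetric function `σ_k` of the eigenvalues of a square matrix `A`, read off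
from `det (t - A) = ∑ (-1)^k σ_k(A) t^(n-k)`. It is a polynomial in the entries of `A`. -/
def sigma {n : ℕ} (k : ℕ) (A : Matrix (Fin n) (Fin n) ℝ) : ℝ :=
  (-1) ^ k * A.charpoly.coeff (n - k)

/-- If `A` has `n` real eigenvalues (with multiplicity), `sigma k A` is the `k`-th elementary
symmetric polynomial of them. -/
theorem sigma_eq_esymm {n k : ℕ} (hk : k ≤ n) (A : Matrix (Fin n) (Fin n) ℝ)
    (hA : A.charpoly.Splits) : sigma k A = A.charpoly.roots.esymm k := by
  have hd : A.charpoly.natDegree = n := by simp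
  have h := Polynomial.coeff_eq_esymm_roots_of_card (Polynomial.splits_iff_card_roots.1 hA)
    (k := n - k) (by rw [hd]; exact Nat.sub_le n k)
  have hnk : n - (n - k) = k := by omega
  rw [sigma, h, hd, hnk, A.charpoly_monic.leadingCoeff, one_mul, ← mul_assoc, ← mul_pow]
  simp

/-- The matrix `⟨A e_i, B e_j⟩`. For `A = B = dX` it is the first fundamental form `g_ij`; for
`A = dX`, `B = dν` it is the second fundamental form `h_ij = ⟨∂_i X, ∂_j ν⟩`. -/
def gram {n : ℕ} (A B : E n →L[ℝ] E (n + 1)) : Matrix (Fin n) (Fin n) ℝ :=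
  Matrix.of fun i j => ⟪A (EuclideanSpace.single i 1), B (EuclideanSpace.single j 1)⟫

/-- `σ_k` of the eigenvalues of `h` with respect to `g`, i.e. of the solutions `κ` of
`det (h - κ g) = 0`, as a function of the matrices `g` and `h`. -/
def sigmaForm {n : ℕ} (k : ℕ) (g h : Matrix (Fin n) (Fin n) ℝ) : ℝ := sigma k (g⁻¹ * h)

/-- `F^{ij} = ∂F/∂h_ij` for `F = σ_k`, with `g` fixed. -/
def dF {n : ℕ} (k : ℕ) (g h : Matrix (Fin n) (Fin n) ℝ) (i j : Fin n) : ℝ :=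
  lineDeriv ℝ (fun B => sigmaForm k g B) h (Matrix.single i j 1)

/-- `F^{ij;ml} = ∂²F/∂h_ij ∂h_ml` for `F = σ_k`, with `g` fixed. -/
def ddF {n : ℕ} (k : ℕ) (g h : Matrix (Fin n) (Fin n) ℝ) (i j m l : Fin n) : ℝ :=
  lineDeriv ℝ (fun B => dF k g B i j) h (Matrix.single m l 1)

section Manifold

variable {n : ℕ} {M : Type*} [TopologicalSpace M] [ChartedSpace (E n) M]

/-- Differential at `x` of a map `f : M → ℝ^{n+1}`, as a linear map on `ℝ^n = T_x M`. -/
def diffAt (f : M → E (n + 1)) (x : M) : E n →L[ℝ] E (n + 1) :=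
  mfderiv (𝓡 n) 𝓘(ℝ, E (n + 1)) f x

/-- `σ_k` of the principal curvatures at `x` of the hypersurface `X : M → ℝ^{n+1}` with unit
normal field `ν`. -/
def sigmaCurv (k : ℕ) (X ν : M → E (n + 1)) (x : M) : ℝ :=
  sigmaForm k (gram (diffAt X x) (diffAt X x)) (gram (diffAt X x) (diffAt ν x))

/-- The support function `u = ⟨X, ν⟩`. -/
def supportFn (X ν : M → E (n + 1)) (x : M) : ℝ := ⟪X x, ν x⟫

end Manifold

section Coordinates

variable {n : ℕ} {V : Type*} [NormedAddCommGroup V] [NormedSpace ℝ V]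

/-- Partial derivative `∂_i f` in local coordinates. -/
def pd (i : Fin n) (f : E n → V) (y : E n) : V := fderiv ℝ f y (EuclideanSpace.single i 1)

/-- Coordinate metric `g_ij` induced by the parametrization `Y`. -/
def metric (Y : E n → E (n + 1)) (y : E n) : Matrix (Fin n) (Fin n) ℝ :=
  gram (fderiv ℝ Y y) (fderiv ℝ Y y)

/-- Second fundamental form `h_ij = ⟨∂_i Y, ∂_j N⟩` of the parametrization `Y` with unit
normal `N`. -/
def secondForm (Y N : E n → E (n + 1)) (y : E n) : Matrix (Fin n) (Fin n) ℝ :=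
  gram (fderiv ℝ Y y) (fderiv ℝ N y)

/-- Christoffel symbols `Γ^l_ij` of the Levi-Civita connection of a metric `g` in coordinates. -/
def christoffel (g : E n → Matrix (Fin n) (Fin n) ℝ) (l i j : Fin n) (y : E n) : ℝ :=
  (1 / 2) * ∑ m, (g y)⁻¹ l m *
    (pd i (fun z => g z j m) y + pd j (fun z => g z i m) y - pd m (fun z => g z i j) y)

/-- Second covariant derivative `f_{ij} = ∂_i ∂_j f - Γ^l_ij ∂_l f` of a function. -/
def covHess (g : E n → Matrix (Fin n) (Fin n) ℝ) (f : E n → ℝ) (i j : Fin n) (y : E n) : ℝ :=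
  pd i (pd j f) y - ∑ l, christoffel g l i j y * pd l f y

/-- Covariant derivative `T_{ij;s} = ∂_s T_ij - Γ^l_si T_lj - Γ^l_sj T_il` of a covariant
2-tensor. -/
def covDeriv (g T : E n → Matrix (Fin n) (Fin n) ℝ) (i j s : Fin n) (y : E n) : ℝ :=
  pd s (fun z => T z i j) y - ∑ l, christoffel g l s i y * T y l j
    - ∑ l, christoffel g l s j y * T y i l

end Coordinates

end PrescribedCurvature

end

open PrescribedCurvature

noncomputable section

namespace PrescribedCurvature

open Filter
open scoped Topology

/-! Write `Q = H/u`, `W = g⁻¹h` and `h²` for `h g⁻¹ h`. Three second-order formulas are combined.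

(1) Simons' identity contracted with `F^{ij}` (`dEval_hess_meanCurvature`): `F^{ij}H_ij = F_ss -
F^{ij;ml}h_ij;s h_ml;s - H F^{ij}(h²)_ij + kF|A|²`. (2) The Hessian of the support function, `u_ij =
⟨X,X_l⟩h_ij;l + h_ij - u(h²)_ij`, contracted with `F^{ij}` (`dEval_hess_support`): `F^{ij}u_ij =
⟨X,X_l⟩F_l + kF - uF^{ij}(h²)_ij`. (3) Its trace (`trace_hess_support`): `u_ss = ⟨X,X_l⟩H_l + H -
u|A|²`.

At a critical point of `Q`, `H_l = Q u_l` and `F^{ij}H_ij = uF^{ij}Q_ij + QF^{ij}u_ij`, while `F =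
φu` gives `F_l = φ_l u + φu_l` and `F_ss = φ_ss u + 2φ_s u_s + φu_ss`. On substitution the terms
`HF^{ij}(h²)_ij` cancel because `Qu = H`, and so do the terms `φQ⟨X,X_l⟩u_l`; dividing the rest by
`u` gives the claim. A maximum matters only as a critical point.

Covariant derivatives are removed by a quadratic change of coordinates with `∂g(p) = 0`
(`exists_quadratic_coordinateChange`): there first covariant derivatives of tensors and Hessians of
functions at `p` are the coordinate ones. Second covariant derivatives of `h` are never formed.
Instead `F` and `H` are differentiated as polynomials in the entries of `W`, and the second
derivatives of `g` and `h` are expressed through derivatives of the parametrization. Simons'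
identity then follows from the symmetry of third and fourth partial derivatives
(`simons_algebraic`), up to a term `X W - h g⁻¹ X`. That term is annihilated by `dσ_k`, since
`σ_k(AB) = σ_k(BA)` forces `dσ_k(A)(MA) = dσ_k(A)(AM)` (`dEval_sigmaPoly_mul_comm`).

Regularity is derived, not assumed: `u > 0` makes `ν` the normalized normal part of `X`, hence `C^3`
in charts, and then `φ = F/u` is `C^2`. -/

/-- A multivariate polynomial is differentiable, with partial derivatives given by `pderiv`. -/
theorem hasFDerivAt_mvPolynomial_eval {ι : Type*} [Fintype ι] (q : MvPolynomial ι ℝ) (x : ι → ℝ) :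
    HasFDerivAt (fun x : ι → ℝ => MvPolynomial.eval x q)
      (∑ i, MvPolynomial.eval x (MvPolynomial.pderiv i q) •
        (ContinuousLinearMap.proj i : (ι → ℝ) →L[ℝ] ℝ)) x := by
  classical
  induction q using MvPolynomial.induction_on with
  | C a => simpa using hasFDerivAt_const a x
  | add p q hp hq =>
    simp only [map_add, add_smul, Finset.sum_add_distrib]
    exact hp.add hq
  | mul_X p j hp =>
    have h := hp.mul (hasFDerivAt_apply (𝕜 := ℝ) j x)
    simp only [map_mul, MvPolynomial.eval_X]
    refine h.congr_fderiv ?_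
    ext v
    simp only [MvPolynomial.pderiv_mul, MvPolynomial.pderiv_X, map_add, map_mul, add_smul,
      MvPolynomial.eval_X, Finset.sum_add_distrib, _root_.add_apply,
      _root_.sum_apply, _root_.smul_apply, ContinuousLinearMap.proj_apply,
      smul_eq_mul, Pi.single_apply, Finset.mul_sum]
    rw [add_comm]
    congr 1
    · exact Finset.sum_congr rfl fun i _ => by ring
    · rw [Finset.sum_eq_single j]
      · simp
      · intro b _ hb
        simp [hb.symm]
      · simp

theorem contDiff_mvPolynomial_eval {ι : Type*} [Fintype ι] (q : MvPolynomial ι ℝ) (m : ℕ∞ω) :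
    ContDiff ℝ m (fun x : ι → ℝ => MvPolynomial.eval x q) := by
  induction q using MvPolynomial.induction_on with
  | C a => simpa using contDiff_const
  | add p q hp hq => simpa using hp.add hq
  | mul_X p j hp => simpa using hp.mul (contDiff_apply ℝ ℝ j)

/-! ### The polynomial `σ_k`: first and second derivatives, Euler's relation, conjugation
invariance. -/

section Sigma

variable {n : ℕ}

/-- `σ_k` as a polynomial in the matrix entries. -/
def sigmaPoly (n k : ℕ) : MvPolynomial (Fin n × Fin n) ℝ :=
  MvPolynomial.C ((-1) ^ k) * (Matrix.charpoly.univ ℝ (Fin n)).coeff (n - k)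

/-- Evaluation of a polynomial in `n × n` variables at the entries of a matrix. -/
def evalMat (q : MvPolynomial (Fin n × Fin n) ℝ) (A : Matrix (Fin n) (Fin n) ℝ) : ℝ :=
  MvPolynomial.eval (fun r => A r.1 r.2) q

theorem sigma_eq_evalMat (k : ℕ) (A : Matrix (Fin n) (Fin n) ℝ) :
    sigma k A = evalMat (sigmaPoly n k) A := by
  have h := Matrix.charpoly.univ_coeff_eval₂Hom (Fin n) (RingHom.id ℝ)
    (fun r : Fin n × Fin n => A r.1 r.2) (n - k)
  rw [sigma, evalMat, sigmaPoly, map_mul, MvPolynomial.eval_C]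
  congr 1
  exact h.symm

/-- Directional derivative of a polynomial in the matrix entries. -/
def dEval (q : MvPolynomial (Fin n × Fin n) ℝ) (A : Matrix (Fin n) (Fin n) ℝ) :
    Matrix (Fin n) (Fin n) ℝ →ₗ[ℝ] ℝ :=
  ∑ r : Fin n × Fin n, evalMat (MvPolynomial.pderiv r q) A • Matrix.entryLinearMap ℝ ℝ r.1 r.2

theorem dEval_apply (q : MvPolynomial (Fin n × Fin n) ℝ) (A M : Matrix (Fin n) (Fin n) ℝ) :
    dEval q A M = ∑ r : Fin n × Fin n, evalMat (MvPolynomial.pderiv r q) A * M r.1 r.2 := by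
  simp [dEval]

/-- Second directional derivative of a polynomial in the matrix entries. -/
def ddEval (q : MvPolynomial (Fin n × Fin n) ℝ) (A : Matrix (Fin n) (Fin n) ℝ) :
    Matrix (Fin n) (Fin n) ℝ →ₗ[ℝ] Matrix (Fin n) (Fin n) ℝ →ₗ[ℝ] ℝ :=
  ∑ r : Fin n × Fin n,
    (Matrix.entryLinearMap ℝ ℝ r.1 r.2).smulRight (dEval (MvPolynomial.pderiv r q) A)

theorem ddEval_apply (q : MvPolynomial (Fin n × Fin n) ℝ) (A M M' : Matrix (Fin n) (Fin n) ℝ) :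
    ddEval q A M M' =
      ∑ r : Fin n × Fin n, M r.1 r.2 * dEval (MvPolynomial.pderiv r q) A M' := by
  simp [ddEval]

/-- Differentiability is required entry by entry, so that no norm on matrices has to be chosen. -/
theorem hasFDerivAt_evalMat {V : Type*} [NormedAddCommGroup V] [NormedSpace ℝ V]
    (q : MvPolynomial (Fin n × Fin n) ℝ) {W : V → Matrix (Fin n) (Fin n) ℝ} {x : V}
    {W' : Fin n → Fin n → V →L[ℝ] ℝ} (hW : ∀ i j, HasFDerivAt (fun y => W y i j) (W' i j) x) :
    HasFDerivAt (fun y => evalMat q (W y))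
      (∑ r : Fin n × Fin n, evalMat (MvPolynomial.pderiv r q) (W x) • W' r.1 r.2) x := by
  have h1 : HasFDerivAt (fun y => fun r : Fin n × Fin n => W y r.1 r.2)
      (ContinuousLinearMap.pi fun r : Fin n × Fin n => W' r.1 r.2) x :=
    hasFDerivAt_pi.2 fun r => hW r.1 r.2
  refine ((hasFDerivAt_mvPolynomial_eval q _).comp x h1).congr_fderiv ?_
  ext v
  simp [evalMat]

theorem contDiffAt_evalMat {V : Type*} [NormedAddCommGroup V] [NormedSpace ℝ V] {m : ℕ∞ω}
    (q : MvPolynomial (Fin n × Fin n) ℝ) {W : V → Matrix (Fin n) (Fin n) ℝ} {x : V}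
    (hW : ∀ i j, ContDiffAt ℝ m (fun y => W y i j) x) :
    ContDiffAt ℝ m (fun y => evalMat q (W y)) x := by
  have h1 : ContDiffAt ℝ m (fun y => fun r : Fin n × Fin n => W y r.1 r.2) x :=
    contDiffAt_pi.2 fun r => hW r.1 r.2
  exact (contDiff_mvPolynomial_eval q m).contDiffAt.comp x h1

theorem hasDerivAt_evalMat_line (q : MvPolynomial (Fin n × Fin n) ℝ)
    (A M : Matrix (Fin n) (Fin n) ℝ) :
    HasDerivAt (fun t : ℝ => evalMat q (A + t • M)) (dEval q A M) 0 := by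
  have h := hasFDerivAt_evalMat q (W := fun t : ℝ => A + t • M) (x := 0)
    (W' := fun i j => ContinuousLinearMap.toSpanSingleton ℝ (M i j)) (fun i j => by
      have := ((hasDerivAt_id (0 : ℝ)).mul_const (M i j)).const_add (A i j)
      simpa using this.hasFDerivAt)
  have h2 := h.hasDerivAt
  simpa [dEval_apply] using h2

theorem sigma_mul_comm (k : ℕ) (A B : Matrix (Fin n) (Fin n) ℝ) :
    sigma k (A * B) = sigma k (B * A) := by
  rw [sigma, sigma, Matrix.charpoly_mul_comm]

/-- Both sides are derivatives at `t = 0` of the same function, because `(1 + tM)A` and `A(1 + tM)`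
have the same characteristic polynomial. This is the infinitesimal conjugation invariance that
removes the non-tensorial term in Simons' identity. -/
theorem dEval_sigmaPoly_mul_comm (k : ℕ) (A M : Matrix (Fin n) (Fin n) ℝ) :
    dEval (sigmaPoly n k) A (M * A) = dEval (sigmaPoly n k) A (A * M) := by
  refine (hasDerivAt_evalMat_line (sigmaPoly n k) A (M * A)).unique ?_
  have h : (fun t : ℝ => evalMat (sigmaPoly n k) (A + t • (M * A))) =
      fun t : ℝ => evalMat (sigmaPoly n k) (A + t • (A * M)) := by
    funext t
    have h1 : A + t • (M * A) = (1 + t • M) * A := by rw [add_mul, one_mul, Matrix.smul_mul]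
    have h2 : A + t • (A * M) = A * (1 + t • M) := by rw [mul_add, mul_one, Matrix.mul_smul]
    rw [← sigma_eq_evalMat, ← sigma_eq_evalMat, h1, h2, sigma_mul_comm]
  rw [h]
  exact hasDerivAt_evalMat_line (sigmaPoly n k) A (A * M)

/-- Euler's relation: `σ_k` is homogeneous of degree `k` in the entries. -/
theorem dEval_sigmaPoly_self {k : ℕ} (hk : k ≤ n) (A : Matrix (Fin n) (Fin n) ℝ) :
    dEval (sigmaPoly n k) A A = k * sigma k A := by
  have hh : (sigmaPoly n k).IsHomogeneous k := by
    have h1 := Matrix.charpoly.univ_coeff_isHomogeneous ℝ (Fin n) (n - k) k (by simp [hk])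
    simpa [sigmaPoly] using (MvPolynomial.isHomogeneous_C (Fin n × Fin n) ((-1 : ℝ) ^ k)).mul h1
  have h2 := congrArg (MvPolynomial.eval fun r : Fin n × Fin n => A r.1 r.2)
    hh.sum_X_mul_pderiv
  rw [sigma_eq_evalMat, dEval_apply]
  simp only [map_sum, map_mul, MvPolynomial.eval_X, nsmul_eq_mul, map_natCast] at h2
  rw [evalMat, ← h2]
  exact Finset.sum_congr rfl fun r _ => mul_comm _ _

theorem lineDeriv_sigmaForm (k : ℕ) (g h M : Matrix (Fin n) (Fin n) ℝ) :
    lineDeriv ℝ (fun B => sigmaForm k g B) h M = dEval (sigmaPoly n k) (g⁻¹ * h) (g⁻¹ * M) := by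
  rw [lineDeriv]
  convert (hasDerivAt_evalMat_line (sigmaPoly n k) (g⁻¹ * h) (g⁻¹ * M)).deriv using 2
  ext t
  rw [sigmaForm, sigma_eq_evalMat, mul_add, Matrix.mul_smul]

theorem linearMap_eq_sum_single (L : Matrix (Fin n) (Fin n) ℝ →ₗ[ℝ] ℝ)
    (B M : Matrix (Fin n) (Fin n) ℝ) :
    ∑ i, ∑ j, L (B * Matrix.single i j 1) * M i j = L (B * M) := by
  conv_rhs => rw [Matrix.matrix_eq_sum_single M]
  simp only [Matrix.mul_sum, map_sum]
  refine Finset.sum_congr rfl fun i _ => Finset.sum_congr rfl fun j _ => ?_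
  have : Matrix.single i j (M i j) = M i j • Matrix.single i j (1 : ℝ) := by simp
  rw [this, Matrix.mul_smul, map_smul, smul_eq_mul, mul_comm]

/-- Turns a contraction with `F^{ij}` into one linear functional, so that matrix algebra replaces
index sums. -/
theorem sum_dF_mul (k : ℕ) (g h M : Matrix (Fin n) (Fin n) ℝ) :
    ∑ i, ∑ j, dF k g h i j * M i j = dEval (sigmaPoly n k) (g⁻¹ * h) (g⁻¹ * M) := by
  simp only [dF, lineDeriv_sigmaForm]
  exact linearMap_eq_sum_single _ _ _

theorem ddF_eq (k : ℕ) (g h : Matrix (Fin n) (Fin n) ℝ) (i j m l : Fin n) :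
    ddF k g h i j m l = ddEval (sigmaPoly n k) (g⁻¹ * h)
      (g⁻¹ * Matrix.single i j 1) (g⁻¹ * Matrix.single m l 1) := by
  simp only [ddF, dF, lineDeriv_sigmaForm]
  rw [lineDeriv, ddEval_apply]
  simp only [dEval_apply (sigmaPoly n k)]
  refine HasDerivAt.deriv ?_
  refine HasDerivAt.fun_sum fun r _ => ?_
  have h1 := (hasDerivAt_evalMat_line (MvPolynomial.pderiv r (sigmaPoly n k)) (g⁻¹ * h)
    (g⁻¹ * Matrix.single m l (1 : ℝ))).mul_const ((g⁻¹ * Matrix.single i j (1 : ℝ)) r.1 r.2)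
  simpa only [mul_add, Matrix.mul_smul, mul_comm] using h1

/-- Bilinear counterpart of `sum_dF_mul`: the basis expansion is used once in each slot. -/
theorem sum_ddF_mul (k : ℕ) (g h M M' : Matrix (Fin n) (Fin n) ℝ) :
    ∑ i, ∑ j, ∑ m, ∑ l, ddF k g h i j m l * M i j * M' m l =
      ddEval (sigmaPoly n k) (g⁻¹ * h) (g⁻¹ * M) (g⁻¹ * M') := by
  have h1 : ∀ i j, ∑ m, ∑ l, ddF k g h i j m l * M i j * M' m l =
      (ddEval (sigmaPoly n k) (g⁻¹ * h)).flip (g⁻¹ * M') (g⁻¹ * Matrix.single i j 1) * M i j := by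
    intro i j
    rw [LinearMap.flip_apply, ← linearMap_eq_sum_single, Finset.sum_mul]
    refine Finset.sum_congr rfl fun m _ => ?_
    rw [Finset.sum_mul]
    refine Finset.sum_congr rfl fun l _ => ?_
    rw [ddF_eq]; ring
  simp only [h1]
  rw [linearMap_eq_sum_single, LinearMap.flip_apply]

theorem sigma_one (hn : 1 ≤ n) (A : Matrix (Fin n) (Fin n) ℝ) : sigma 1 A = A.trace := by
  have : Nonempty (Fin n) := ⟨⟨0, hn⟩⟩
  rw [sigma, Matrix.trace_eq_neg_charpoly_coeff]
  simp

/-- `σ_k` of the eigenvalues of `h` relative to `g` is invariant under congruence. -/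
theorem sigmaForm_congruence (k : ℕ) (g h : Matrix (Fin n) (Fin n) ℝ)
    {J : Matrix (Fin n) (Fin n) ℝ} (hJ : IsUnit J.det) :
    sigmaForm k (J.transpose * g * J) (J.transpose * h * J) = sigmaForm k g h := by
  have hJt : IsUnit J.transpose.det := by rwa [Matrix.det_transpose]
  rw [sigmaForm, sigmaForm, Matrix.mul_inv_rev, Matrix.mul_inv_rev, sigma_mul_comm]
  have : J.transpose * h * J * (J⁻¹ * (g⁻¹ * J.transpose⁻¹)) =
      J.transpose * (h * g⁻¹ * J.transpose⁻¹) := by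
    simp only [mul_assoc]
    rw [Matrix.mul_nonsing_inv_cancel_left _ _ hJ]
  rw [this, sigma_mul_comm, mul_assoc, Matrix.nonsing_inv_mul _ hJt, mul_one, sigma_mul_comm]

end Sigma

/-! ### Gram matrices and the splitting into tangential and normal parts. -/

section LinearAlgebra

variable {n : ℕ}

theorem gram_apply (A B : E n →L[ℝ] E (n + 1)) (i j : Fin n) :
    gram A B i j = ⟪A (EuclideanSpace.single i 1), B (EuclideanSpace.single j 1)⟫ := rfl

theorem euclidean_eq_sum_single (v : E n) : v = ∑ i, v i • EuclideanSpace.single i (1 : ℝ) := by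
  ext j
  simp [Pi.single_apply]

theorem map_euclidean_eq_sum {V : Type*} [NormedAddCommGroup V] [NormedSpace ℝ V]
    (L : E n →L[ℝ] V) (v : E n) : L v = ∑ i, v i • L (EuclideanSpace.single i (1 : ℝ)) := by
  conv_lhs => rw [euclidean_eq_sum_single v]
  simp

theorem gram_transpose (A : E n →L[ℝ] E (n + 1)) : (gram A A).transpose = gram A A := by
  ext i j
  simp only [Matrix.transpose_apply, gram_apply, real_inner_comm]

theorem isUnit_det_gram {A : E n →L[ℝ] E (n + 1)} (hA : Function.Injective A) :
    IsUnit (gram A A).det := by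
  have hli : LinearIndependent ℝ fun i : Fin n => A (EuclideanSpace.single i (1 : ℝ)) := by
    have h1 : LinearIndependent ℝ fun i : Fin n => EuclideanSpace.single i (1 : ℝ) := by
      have h0 := (EuclideanSpace.basisFun (Fin n) ℝ).toBasis.linearIndependent
      have h2 : ((EuclideanSpace.basisFun (Fin n) ℝ).toBasis : Fin n → E n) =
          fun i => EuclideanSpace.single i (1 : ℝ) := by ext; simp
      rwa [h2] at h0
    exact h1.map' (A : E n →ₗ[ℝ] E (n + 1)) (LinearMap.ker_eq_bot.2 hA)
  have h2 := (Matrix.posDef_gram_of_linearIndependent hli).det_pos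
  exact isUnit_iff_ne_zero.2 (ne_of_gt h2)

/-- Decomposition of a vector into its tangential and normal parts. -/
theorem eq_tangential_add_normal {A : E n →L[ℝ] E (n + 1)} (hA : Function.Injective A)
    {ν : E (n + 1)} (hν : ‖ν‖ = 1) (hperp : ∀ v, ⟪A v, ν⟫ = 0) (w : E (n + 1)) :
    w = (∑ a, ∑ b, ((gram A A)⁻¹ a b * ⟪w, A (EuclideanSpace.single b 1)⟫) •
      A (EuclideanSpace.single a 1)) + ⟪w, ν⟫ • ν := by
  set B := (gram A A)⁻¹ with hB
  set t := ∑ a, ∑ b, (B a b * ⟪w, A (EuclideanSpace.single b 1)⟫) •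
      A (EuclideanSpace.single a 1) with ht
  have htν : ⟪t, ν⟫ = 0 := by
    simp only [ht, sum_inner, real_inner_smul_left, hperp, mul_zero, Finset.sum_const_zero]
  have hte : ∀ c, ⟪w - t, A (EuclideanSpace.single c 1)⟫ = 0 := by
    intro c
    have h1 : ∀ b, ∑ a, gram A A c a * B a b = (1 : Matrix (Fin n) (Fin n) ℝ) c b := by
      intro b
      rw [← Matrix.mul_apply, hB, Matrix.mul_nonsing_inv _ (isUnit_det_gram hA)]
    have h2 : ⟪t, A (EuclideanSpace.single c 1)⟫ =
        ∑ b, (∑ a, gram A A c a * B a b) * ⟪w, A (EuclideanSpace.single b 1)⟫ := by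
      simp only [ht, sum_inner, real_inner_smul_left, Finset.sum_mul]
      rw [Finset.sum_comm]
      refine Finset.sum_congr rfl fun b _ => Finset.sum_congr rfl fun a _ => ?_
      rw [gram_apply, real_inner_comm (A (EuclideanSpace.single a 1))]
      ring
    rw [inner_sub_left, h2]
    simp [h1, Matrix.one_apply]
  -- The tangent space has codimension one, so its orthogonal complement is the line through `ν`;
  -- what remains of `w` after subtracting `t` lies on that line.
  let K : Submodule ℝ (E (n + 1)) := LinearMap.range (A : E n →ₗ[ℝ] E (n + 1))
  have hK : Module.finrank ℝ K = n := by
    have := LinearMap.finrank_range_of_inj (f := (A : E n →ₗ[ℝ] E (n + 1))) hA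
    simpa using this
  have hKp : Module.finrank ℝ Kᗮ = 1 := by
    have h3 := K.finrank_add_finrank_orthogonal
    rw [hK] at h3
    simp at h3
    exact h3
  have hνK : ν ∈ Kᗮ := by
    rw [Submodule.mem_orthogonal]
    rintro _ ⟨v, rfl⟩
    exact hperp v
  have hwK : w - t ∈ Kᗮ := by
    rw [Submodule.mem_orthogonal]
    rintro _ ⟨v, rfl⟩
    change ⟪A v, w - t⟫ = 0
    rw [map_euclidean_eq_sum A v, sum_inner]
    refine Finset.sum_eq_zero fun i _ => ?_
    rw [real_inner_smul_left, real_inner_comm, hte, mul_zero]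
  have hν0 : (⟨ν, hνK⟩ : Kᗮ) ≠ 0 := by
    intro h
    have : ν = 0 := congrArg Subtype.val h
    simp [this] at hν
  obtain ⟨c, hc⟩ := (finrank_eq_one_iff_of_nonzero' _ hν0).1 hKp ⟨w - t, hwK⟩
  have hc' : c • ν = w - t := congrArg Subtype.val hc
  have hcw : c = ⟪w, ν⟫ := by
    have h4 : ⟪w - t, ν⟫ = ⟪w, ν⟫ := by rw [inner_sub_left, htν, sub_zero]
    rw [← h4, ← hc', real_inner_smul_left, real_inner_self_eq_norm_sq, hν]
    ring
  rw [← hcw, hc']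
  abel

theorem inner_eq_tangential_add_normal {A : E n →L[ℝ] E (n + 1)} (hA : Function.Injective A)
    {ν : E (n + 1)} (hν : ‖ν‖ = 1) (hperp : ∀ v, ⟪A v, ν⟫ = 0) (v w : E (n + 1)) :
    ⟪v, w⟫ = (∑ a, ∑ b, (gram A A)⁻¹ a b * ⟪v, A (EuclideanSpace.single a 1)⟫ *
      ⟪w, A (EuclideanSpace.single b 1)⟫) + ⟪v, ν⟫ * ⟪w, ν⟫ := by
  conv_lhs => rw [eq_tangential_add_normal hA hν hperp w]
  simp only [inner_add_right, inner_sum, real_inner_smul_right]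
  rw [mul_comm ⟪v, ν⟫]
  congr 1
  exact Finset.sum_congr rfl fun a _ => Finset.sum_congr rfl fun b _ => by ring

/-- The matrix of a linear endomorphism of `ℝ^n`. -/
def matrixOf (J : E n →L[ℝ] E n) : Matrix (Fin n) (Fin n) ℝ :=
  Matrix.of fun i j => J (EuclideanSpace.single j 1) i

theorem gram_comp (A B : E n →L[ℝ] E (n + 1)) (J : E n →L[ℝ] E n) :
    gram (A.comp J) (B.comp J) = (matrixOf J).transpose * gram A B * matrixOf J := by
  ext i j
  rw [gram_apply, ContinuousLinearMap.comp_apply, ContinuousLinearMap.comp_apply,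
    map_euclidean_eq_sum A, map_euclidean_eq_sum B]
  simp only [sum_inner, inner_sum, real_inner_smul_left, real_inner_smul_right, Matrix.mul_apply,
    Finset.sum_mul, Matrix.transpose_apply, matrixOf, Matrix.of_apply, gram_apply]
  exact Finset.sum_congr rfl fun a _ => Finset.sum_congr rfl fun b _ => by ring

theorem matrixOf_comp (J K : E n →L[ℝ] E n) :
    matrixOf (J.comp K) = matrixOf J * matrixOf K := by
  ext i j
  simp only [matrixOf, Matrix.of_apply, ContinuousLinearMap.comp_apply, Matrix.mul_apply]
  rw [map_euclidean_eq_sum J]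
  simp [mul_comm]

theorem isUnit_det_matrixOf {J K : E n →L[ℝ] E n} (h : J.comp K = ContinuousLinearMap.id ℝ _) :
    IsUnit (matrixOf K).det := by
  have h1 : matrixOf J * matrixOf K = 1 := by
    rw [← matrixOf_comp, h]
    ext i j
    simp [matrixOf, Matrix.one_apply]
  have h2 := congrArg Matrix.det h1
  rw [Matrix.det_mul, Matrix.det_one] at h2
  exact IsUnit.of_mul_eq_one _ ((mul_comm _ _).trans h2)

end LinearAlgebra

/-! ### Calculus of coordinate partial derivatives. -/

section PartialDerivatives

variable {n : ℕ} {V : Type*} [NormedAddCommGroup V] [NormedSpace ℝ V]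

theorem contDiffAt_pd {m m' : ℕ∞ω} {f : E n → V} {y : E n} (hf : ContDiffAt ℝ m' f y)
    (hm : m + 1 ≤ m') (i : Fin n) : ContDiffAt ℝ m (pd i f) y :=
  (hf.fderiv_right hm).clm_apply contDiffAt_const

theorem pd_congr {f f' : E n → V} {y : E n} (h : f =ᶠ[𝓝 y] f') (i : Fin n) :
    pd i f =ᶠ[𝓝 y] pd i f' := by
  filter_upwards [h.fderiv (𝕜 := ℝ)] with z hz
  rw [pd, pd, hz]

theorem pd_add {f f' : E n → V} {y : E n} (hf : DifferentiableAt ℝ f y)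
    (hf' : DifferentiableAt ℝ f' y) (i : Fin n) :
    pd i (fun z => f z + f' z) y = pd i f y + pd i f' y := by
  simp only [pd]
  rw [fderiv_fun_add hf hf']; rfl

theorem pd_neg {f : E n → V} {y : E n} (i : Fin n) :
    pd i (fun z => -f z) y = -pd i f y := by
  simp only [pd]
  rw [fderiv_fun_neg]; rfl

theorem pd_const {c : V} {y : E n} (i : Fin n) : pd i (fun _ => c) y = 0 := by
  simp [pd]

theorem pd_sum {ι : Type*} {s : Finset ι} {f : ι → E n → V} {y : E n}
    (hf : ∀ a ∈ s, DifferentiableAt ℝ (f a) y) (i : Fin n) :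
    pd i (fun z => ∑ a ∈ s, f a z) y = ∑ a ∈ s, pd i (f a) y := by
  simp only [pd]
  rw [fderiv_fun_sum hf]; simp

theorem pd_mul {f f' : E n → ℝ} {y : E n} (hf : DifferentiableAt ℝ f y)
    (hf' : DifferentiableAt ℝ f' y) (i : Fin n) :
    pd i (fun z => f z * f' z) y = pd i f y * f' y + f y * pd i f' y := by
  simp only [pd]
  rw [fderiv_fun_mul hf hf']
  simp only [_root_.add_apply, _root_.smul_apply, smul_eq_mul]
  ring

theorem pd_inner {m : ℕ} {f f' : E n → E m} {y : E n} (hf : DifferentiableAt ℝ f y)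
    (hf' : DifferentiableAt ℝ f' y) (i : Fin n) :
    pd i (fun z => ⟪f z, f' z⟫) y = ⟪pd i f y, f' y⟫ + ⟪f y, pd i f' y⟫ := by
  simp only [pd]
  rw [fderiv_inner_apply ℝ hf hf', add_comm]

theorem pd_comm {f : E n → V} {y : E n} (hf : ContDiffAt ℝ 2 f y) (i j : Fin n) :
    pd i (pd j f) y = pd j (pd i f) y := by
  have hd : DifferentiableAt ℝ (fderiv ℝ f) y :=
    (hf.fderiv_right (m := 1) (by norm_num)).differentiableAt (by norm_num)
  have h : ∀ i j : Fin n, pd i (pd j f) y =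
      fderiv ℝ (fderiv ℝ f) y (EuclideanSpace.single i 1) (EuclideanSpace.single j 1) := by
    intro i j
    have := fderiv_clm_apply hd
      (differentiableAt_const (𝕜 := ℝ) (EuclideanSpace.single j (1 : ℝ)))
    change fderiv ℝ (fun z => fderiv ℝ f z (EuclideanSpace.single j 1)) y _ = _
    rw [this]
    simp
  rw [h, h]
  exact (hf.isSymmSndFDerivAt (by simp)) _ _

theorem pd_comm_eventually {f : E n → V} {y : E n} (hf : ContDiffAt ℝ 2 f y) (i j : Fin n) :
    pd i (pd j f) =ᶠ[𝓝 y] pd j (pd i f) := by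
  filter_upwards [hf.eventually (by simp)] with z hz
  exact pd_comm hz i j

/-- Near a point where `f` is `C^1`, `f` is differentiable. -/
theorem eventually_differentiableAt {m : ℕ∞ω} {f : E n → V} {y : E n} (hf : ContDiffAt ℝ m f y)
    (hm : 1 ≤ m) : ∀ᶠ z in 𝓝 y, DifferentiableAt ℝ f z := by
  filter_upwards [(hf.of_le hm).eventually (by simp)] with z hz
  exact hz.differentiableAt (by simp)

theorem pd_pd_mul {f f' : E n → ℝ} {y : E n} (hf : ContDiffAt ℝ 2 f y)
    (hf' : ContDiffAt ℝ 2 f' y) (i j : Fin n) :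
    pd i (pd j (fun z => f z * f' z)) y = pd i (pd j f) y * f' y + pd j f y * pd i f' y +
      (pd i f y * pd j f' y + f y * pd i (pd j f') y) := by
  have h1 : pd j (fun z => f z * f' z) =ᶠ[𝓝 y] fun z => pd j f z * f' z + f z * pd j f' z := by
    filter_upwards [eventually_differentiableAt hf (by simp),
      eventually_differentiableAt hf' (by simp)] with z hz hz'
    exact pd_mul hz hz' j
  have d1 := (contDiffAt_pd (m := 1) hf (by norm_num) j).differentiableAt (by simp)
  have d2 := (contDiffAt_pd (m := 1) hf' (by norm_num) j).differentiableAt (by simp)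
  have d3 := hf.differentiableAt (by simp)
  have d4 := hf'.differentiableAt (by simp)
  rw [(pd_congr h1 i).self_of_nhds, pd_add (d1.fun_mul d4) (d3.fun_mul d2), pd_mul d1 d4,
    pd_mul d3 d2]

theorem pd_evalMat {W : E n → Matrix (Fin n) (Fin n) ℝ} {y : E n}
    (q : MvPolynomial (Fin n × Fin n) ℝ) (hW : ∀ i j, DifferentiableAt ℝ (fun z => W z i j) y)
    (s : Fin n) :
    pd s (fun z => evalMat q (W z)) y =
      dEval q (W y) (Matrix.of fun i j => pd s (fun z => W z i j) y) := by
  rw [pd, (hasFDerivAt_evalMat q fun i j => (hW i j).hasFDerivAt).fderiv, dEval_apply]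
  simp [pd]

theorem pd_pd_evalMat {W : E n → Matrix (Fin n) (Fin n) ℝ} {y : E n}
    (q : MvPolynomial (Fin n × Fin n) ℝ) (hW : ∀ i j, ContDiffAt ℝ 2 (fun z => W z i j) y)
    (s t : Fin n) :
    pd s (pd t (fun z => evalMat q (W z))) y =
      ddEval q (W y) (Matrix.of fun i j => pd t (fun z => W z i j) y)
        (Matrix.of fun i j => pd s (fun z => W z i j) y) +
      dEval q (W y) (Matrix.of fun i j => pd s (pd t (fun z => W z i j)) y) := by
  have hev : ∀ᶠ z in 𝓝 y, ∀ i j, DifferentiableAt ℝ (fun z => W z i j) z := by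
    simp only [eventually_all]
    exact fun i j => eventually_differentiableAt (hW i j) (by simp)
  have h1 : pd t (fun z => evalMat q (W z)) =ᶠ[𝓝 y] fun z => ∑ r : Fin n × Fin n,
      evalMat (MvPolynomial.pderiv r q) (W z) * pd t (fun z => W z r.1 r.2) z := by
    filter_upwards [hev] with z hz
    rw [pd_evalMat q hz, dEval_apply]
    rfl
  have d1 : ∀ r : Fin n × Fin n, DifferentiableAt ℝ
      (fun z => evalMat (MvPolynomial.pderiv r q) (W z)) y := fun r =>
    (contDiffAt_evalMat (m := 2) _ hW).differentiableAt (by simp)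
  have d2 : ∀ r : Fin n × Fin n, DifferentiableAt ℝ (pd t (fun z => W z r.1 r.2)) y := fun r =>
    (contDiffAt_pd (m := 1) (hW r.1 r.2) (by norm_num) t).differentiableAt (by simp)
  rw [(pd_congr h1 s).self_of_nhds, pd_sum fun r _ => (d1 r).fun_mul (d2 r), ddEval_apply,
    dEval_apply, ← Finset.sum_add_distrib]
  refine Finset.sum_congr rfl fun r _ => ?_
  rw [pd_mul (d1 r) (d2 r), pd_evalMat _ hev.self_of_nhds]
  simp only [Matrix.of_apply]
  ring

end PartialDerivatives

/-! ### Smoothness of determinants, inverses and products of matrix functions. -/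

section Smoothness

variable {n : ℕ} {V : Type*} [NormedAddCommGroup V] [NormedSpace ℝ V] {m : ℕ∞ω}
  {G : V → Matrix (Fin n) (Fin n) ℝ} {x : V}

theorem contDiffAt_det (hG : ∀ i j, ContDiffAt ℝ m (fun y => G y i j) x) :
    ContDiffAt ℝ m (fun y => (G y).det) x := by
  simp only [Matrix.det_apply]
  exact ContDiffAt.sum fun τ _ => (contDiffAt_prod fun i _ => hG _ _).const_smul _

theorem contDiffAt_inv_apply (hG : ∀ i j, ContDiffAt ℝ m (fun y => G y i j) x)
    (hx : IsUnit (G x).det) (i j : Fin n) : ContDiffAt ℝ m (fun y => (G y)⁻¹ i j) x := by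
  simp only [Matrix.inv_def, Ring.inverse_eq_inv', Matrix.smul_apply, smul_eq_mul,
    Matrix.adjugate_apply]
  refine ((contDiffAt_det hG).inv hx.ne_zero).mul (contDiffAt_det fun a b => ?_)
  by_cases h : a = j
  · subst h
    simpa using contDiffAt_const
  · simpa [Matrix.updateRow_ne h] using hG a b

theorem contDiffAt_mul_apply {G' : V → Matrix (Fin n) (Fin n) ℝ}
    (hG : ∀ i j, ContDiffAt ℝ m (fun y => G y i j) x)
    (hG' : ∀ i j, ContDiffAt ℝ m (fun y => G' y i j) x) (i j : Fin n) :
    ContDiffAt ℝ m (fun y => (G y * G' y) i j) x := by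
  simp only [Matrix.mul_apply]
  exact ContDiffAt.sum fun a _ => (hG i a).mul (hG' a j)

end Smoothness

/-! ### Structure equations of a parametrized hypersurface. -/

/-- A `C^4` parametrized hypersurface `Y` near `p`, with `C^3` unit normal field `N`. -/
structure HypersurfacePatch {n : ℕ} (Y N : E n → E (n + 1)) (p : E n) : Prop where
  contDiffAt_param : ContDiffAt ℝ 4 Y p
  contDiffAt_normal : ContDiffAt ℝ 3 N p
  injective_fderiv : Function.Injective (fderiv ℝ Y p)
  norm_normal : ∀ᶠ y in 𝓝 p, ‖N y‖ = 1
  inner_fderiv_normal : ∀ᶠ y in 𝓝 p, ∀ v, ⟪fderiv ℝ Y y v, N y⟫ = 0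

namespace HypersurfacePatch

variable {n : ℕ} {Y N : E n → E (n + 1)} {p : E n}

theorem isUnit_det_metric (P : HypersurfacePatch Y N p) : IsUnit (metric Y p).det :=
  isUnit_det_gram P.injective_fderiv

theorem contDiffAt_metric (P : HypersurfacePatch Y N p) (i j : Fin n) :
    ContDiffAt ℝ 3 (fun y => metric Y y i j) p :=
  (contDiffAt_pd P.contDiffAt_param (by norm_num) i).inner ℝ
    (contDiffAt_pd P.contDiffAt_param (by norm_num) j)

theorem contDiffAt_secondForm (P : HypersurfacePatch Y N p) (i j : Fin n) :
    ContDiffAt ℝ 2 (fun y => secondForm Y N y i j) p :=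
  (contDiffAt_pd P.contDiffAt_param (by norm_num) i).inner ℝ
    (contDiffAt_pd P.contDiffAt_normal (by norm_num) j)

theorem contDiffAt_support (P : HypersurfacePatch Y N p) :
    ContDiffAt ℝ 3 (fun y => ⟪Y y, N y⟫) p :=
  (P.contDiffAt_param.of_le (by norm_num)).inner ℝ P.contDiffAt_normal

theorem contDiffAt_shape (P : HypersurfacePatch Y N p) (i j : Fin n) :
    ContDiffAt ℝ 2 (fun y => ((metric Y y)⁻¹ * secondForm Y N y) i j) p :=
  contDiffAt_mul_apply
    (contDiffAt_inv_apply (fun a b => (P.contDiffAt_metric a b).of_le (by norm_num))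
      P.isUnit_det_metric) P.contDiffAt_secondForm i j

theorem inner_pd_normal_self (P : HypersurfacePatch Y N p) (i : Fin n) :
    ∀ᶠ y in 𝓝 p, ⟪pd i N y, N y⟫ = 0 := by
  have h : (fun y => ⟪N y, N y⟫) =ᶠ[𝓝 p] fun _ => (1 : ℝ) := by
    filter_upwards [P.norm_normal] with y hy
    rw [real_inner_self_eq_norm_sq, hy, one_pow]
  filter_upwards [pd_congr h i, eventually_differentiableAt P.contDiffAt_normal (by norm_num)]
    with y hy hd
  rw [pd_inner hd hd, pd_const, real_inner_comm (pd i N y)] at hy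
  linarith

theorem inner_pd_normal (P : HypersurfacePatch Y N p) (i : Fin n) :
    ∀ᶠ y in 𝓝 p, ⟪pd i Y y, N y⟫ = 0 := by
  filter_upwards [P.inner_fderiv_normal] with y hy
  exact hy _

/-- Differentiate `⟨∂_i Y, N⟩ = 0`. The formula holds near `p`, so it can be differentiated again,
and it makes the symmetry of `h` visible. -/
theorem secondForm_eventually (P : HypersurfacePatch Y N p) (i j : Fin n) :
    (fun y => secondForm Y N y i j) =ᶠ[𝓝 p] fun y => -⟪pd j (pd i Y) y, N y⟫ := by
  have h : (fun y => ⟪pd i Y y, N y⟫) =ᶠ[𝓝 p] fun _ => (0 : ℝ) := P.inner_pd_normal i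
  have h1 : ContDiffAt ℝ 3 (pd i Y) p := contDiffAt_pd P.contDiffAt_param (by norm_num) i
  filter_upwards [pd_congr h j, eventually_differentiableAt P.contDiffAt_normal (by norm_num),
    eventually_differentiableAt h1 (by norm_num)] with y hy hd hd'
  rw [pd_inner hd' hd, pd_const] at hy
  change ⟪pd i Y y, pd j N y⟫ = _
  linarith

theorem secondForm_comm (P : HypersurfacePatch Y N p) (i j : Fin n) :
    (fun y => secondForm Y N y i j) =ᶠ[𝓝 p] fun y => secondForm Y N y j i := by
  filter_upwards [P.secondForm_eventually i j, P.secondForm_eventually j i,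
    pd_comm_eventually (P.contDiffAt_param.of_le (by norm_num)) i j] with y h1 h2 h3
  rw [h1, h2, h3]

theorem secondForm_symm (P : HypersurfacePatch Y N p) (i j : Fin n) :
    secondForm Y N p i j = secondForm Y N p j i := (P.secondForm_comm i j).self_of_nhds

theorem transpose_secondForm (P : HypersurfacePatch Y N p) :
    (secondForm Y N p).transpose = secondForm Y N p := by
  ext i j
  exact P.secondForm_symm j i

theorem inner_eq (P : HypersurfacePatch Y N p) (v w : E (n + 1)) :
    ⟪v, w⟫ = (∑ a, ∑ b, (metric Y p)⁻¹ a b * ⟪v, pd a Y p⟫ * ⟪w, pd b Y p⟫) +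
      ⟪v, N p⟫ * ⟪w, N p⟫ :=
  inner_eq_tangential_add_normal P.injective_fderiv P.norm_normal.self_of_nhds
    P.inner_fderiv_normal.self_of_nhds v w

theorem inner_pd_normal_pd_normal (P : HypersurfacePatch Y N p) (s t : Fin n) :
    ⟪pd s N p, pd t N p⟫ =
      (secondForm Y N p * (metric Y p)⁻¹ * secondForm Y N p) s t := by
  rw [P.inner_eq, (P.inner_pd_normal_self s).self_of_nhds, zero_mul, add_zero, Finset.sum_comm]
  simp only [Matrix.mul_apply, Finset.sum_mul]
  refine Finset.sum_congr rfl fun b _ => Finset.sum_congr rfl fun a _ => ?_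
  have h1 : ⟪pd s N p, pd a Y p⟫ = secondForm Y N p s a := by
    rw [P.secondForm_symm s a, real_inner_comm]; rfl
  have h2 : ⟪pd t N p, pd b Y p⟫ = secondForm Y N p b t := by
    rw [real_inner_comm]; rfl
  rw [h1, h2]; ring

/-- Differentiate `⟨∂_t N, N⟩ = 0` and insert the third fundamental form. -/
theorem inner_pd_pd_normal_self (P : HypersurfacePatch Y N p) (s t : Fin n) :
    ⟪pd s (pd t N) p, N p⟫ =
      -(secondForm Y N p * (metric Y p)⁻¹ * secondForm Y N p) s t := by
  have h : (fun y => ⟪pd t N y, N y⟫) =ᶠ[𝓝 p] fun _ => (0 : ℝ) := P.inner_pd_normal_self t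
  have h1 := (pd_congr h s).self_of_nhds
  rw [pd_inner ((contDiffAt_pd (m := 2) P.contDiffAt_normal (by norm_num) t).differentiableAt
    (by norm_num)) (P.contDiffAt_normal.differentiableAt (by norm_num)), pd_const,
    real_inner_comm (pd s N p), P.inner_pd_normal_pd_normal] at h1
  linarith

/-- Weingarten's equation `∂_s N = W^c_s ∂_c Y`, paired with an arbitrary vector. -/
theorem inner_pd_normal_of_tangent (P : HypersurfacePatch Y N p) (v : E (n + 1)) (s : Fin n) :
    ⟪v, pd s N p⟫ = ∑ c, ⟪v, pd c Y p⟫ * ((metric Y p)⁻¹ * secondForm Y N p) c s := by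
  rw [P.inner_eq, (P.inner_pd_normal_self s).self_of_nhds, mul_zero, add_zero]
  refine Finset.sum_congr rfl fun c _ => ?_
  rw [Matrix.mul_apply, Finset.mul_sum]
  refine Finset.sum_congr rfl fun b _ => ?_
  have h2 : ⟪pd s N p, pd b Y p⟫ = secondForm Y N p b s := by
    rw [real_inner_comm]; rfl
  rw [h2]; ring

theorem transpose_metric : (metric Y p).transpose = metric Y p := gram_transpose _

/-- In coordinates with `∂g(p) = 0` the second derivatives of the parametrization are normal. -/
theorem inner_pd_pd_pd (P : HypersurfacePatch Y N p)
    (hg : ∀ s i j, pd s (fun y => metric Y y i j) p = 0) (i j m : Fin n) :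
    ⟪pd i (pd j Y) p, pd m Y p⟫ = 0 := by
  have hd : ∀ a, DifferentiableAt ℝ (pd a Y) p := fun a =>
    (contDiffAt_pd (m := 3) P.contDiffAt_param (by norm_num) a).differentiableAt (by norm_num)
  have h : ∀ s a b, ⟪pd s (pd a Y) p, pd b Y p⟫ + ⟪pd s (pd b Y) p, pd a Y p⟫ = 0 := by
    intro s a b
    have h1 := hg s a b
    change pd s (fun y => ⟪pd a Y y, pd b Y y⟫) p = 0 at h1
    rwa [pd_inner (hd a) (hd b), real_inner_comm (pd s (pd b Y) p)] at h1
  have hc : ∀ a b, pd a (pd b Y) p = pd b (pd a Y) p := fun a b =>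
    pd_comm (P.contDiffAt_param.of_le (by norm_num)) a b
  have h1 := h i j m
  have h2 := h j i m
  have h3 := h m i j
  rw [hc j i, hc j m] at h2
  rw [hc m i] at h3
  -- Koszul's trick: adding the first two relations and subtracting the third leaves twice the
  -- required inner product.
  linarith

theorem inner_pd_pd_normal (P : HypersurfacePatch Y N p) (i j : Fin n) :
    ⟪pd i (pd j Y) p, N p⟫ = -secondForm Y N p i j := by
  have h1 : secondForm Y N p j i = -⟪pd i (pd j Y) p, N p⟫ :=
    (P.secondForm_eventually j i).self_of_nhds
  rw [P.secondForm_symm, h1, neg_neg]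

theorem inner_pd_pd_pd_normal (P : HypersurfacePatch Y N p)
    (hg : ∀ s i j, pd s (fun y => metric Y y i j) p = 0) (i j s : Fin n) :
    ⟪pd i (pd j Y) p, pd s N p⟫ = 0 := by
  rw [P.inner_pd_normal_of_tangent]
  exact Finset.sum_eq_zero fun c _ => by rw [P.inner_pd_pd_pd hg, zero_mul]

/-- Differentiating `-⟨∂_i∂_j Y, N⟩` leaves only this term: `∂_i∂_j Y` is normal at `p` while `∂_s
N` is tangential. -/
theorem pd_secondForm (P : HypersurfacePatch Y N p)
    (hg : ∀ s i j, pd s (fun y => metric Y y i j) p = 0) (s i j : Fin n) :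
    pd s (fun y => secondForm Y N y i j) p = -⟪pd s (pd i (pd j Y)) p, N p⟫ := by
  rw [(pd_congr ((P.secondForm_comm i j).trans (P.secondForm_eventually j i)) s).self_of_nhds,
    pd_neg, pd_inner, P.inner_pd_pd_pd_normal hg, add_zero]
  · exact (contDiffAt_pd (m := 2) (contDiffAt_pd (m := 3) P.contDiffAt_param (by norm_num) j)
      (by norm_num) i).differentiableAt (by norm_num)
  · exact P.contDiffAt_normal.differentiableAt (by norm_num)

/-- Third derivatives commute. -/
theorem pd_pd_pd_comm (P : HypersurfacePatch Y N p) (i j k : Fin n) :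
    pd i (pd j (pd k Y)) =ᶠ[𝓝 p] pd j (pd i (pd k Y)) ∧
      pd i (pd j (pd k Y)) =ᶠ[𝓝 p] pd i (pd k (pd j Y)) :=
  ⟨pd_comm_eventually (contDiffAt_pd P.contDiffAt_param (by norm_num) k) i j,
    pd_congr (pd_comm_eventually (P.contDiffAt_param.of_le (by norm_num)) j k) i⟩

theorem pd_pd_pd_pd_comm (P : HypersurfacePatch Y N p) (i j k l : Fin n) :
    pd i (pd j (pd k (pd l Y))) p = pd k (pd l (pd i (pd j Y))) p := by
  have h1 := (pd_congr (P.pd_pd_pd_comm j k l).1 i).self_of_nhds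
  have h2 : pd i (pd k (pd j (pd l Y))) p = pd k (pd i (pd j (pd l Y))) p :=
    pd_comm (contDiffAt_pd (m := 2) (contDiffAt_pd (m := 3) P.contDiffAt_param (by norm_num) l)
      (by norm_num) j) i k
  have h3 := (pd_congr (((P.pd_pd_pd_comm i j l).2.trans (P.pd_pd_pd_comm i l j).1)) k).self_of_nhds
  rw [h1, h2, h3]

/-- Codazzi equation in coordinates with `∂g(p) = 0`. -/
theorem pd_secondForm_comm (P : HypersurfacePatch Y N p)
    (hg : ∀ s i j, pd s (fun y => metric Y y i j) p = 0) (s i j : Fin n) :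
    pd s (fun y => secondForm Y N y i j) p = pd i (fun y => secondForm Y N y s j) p := by
  rw [P.pd_secondForm hg, P.pd_secondForm hg, (P.pd_pd_pd_comm s i j).1.self_of_nhds]

/-- Second derivative of `-⟨∂_i∂_j Y, N⟩`. Weingarten's equation turns the two mixed terms into
tangential components of third derivatives of `Y`; in the last one only the normal parts of `∂_i∂_j
Y` and `∂_s∂_t N` meet. -/
theorem pd_pd_secondForm (P : HypersurfacePatch Y N p)
    (hg : ∀ s i j, pd s (fun y => metric Y y i j) p = 0) (s t i j : Fin n) :
    pd s (pd t (fun y => secondForm Y N y i j)) p =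
      -⟪pd s (pd t (pd i (pd j Y))) p, N p⟫
      - ∑ c, ⟪pd t (pd i (pd j Y)) p, pd c Y p⟫ * ((metric Y p)⁻¹ * secondForm Y N p) c s
      - ∑ c, ⟪pd s (pd i (pd j Y)) p, pd c Y p⟫ * ((metric Y p)⁻¹ * secondForm Y N p) c t
      - secondForm Y N p i j *
        (secondForm Y N p * (metric Y p)⁻¹ * secondForm Y N p) s t := by
  have hT : ContDiffAt ℝ 2 (pd i (pd j Y)) p :=
    contDiffAt_pd (contDiffAt_pd (m := 3) P.contDiffAt_param (by norm_num) j) (by norm_num) i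
  have hN : ContDiffAt ℝ 3 N p := P.contDiffAt_normal
  have h1 : pd t (fun y => secondForm Y N y i j) =ᶠ[𝓝 p]
      fun y => -(⟪pd t (pd i (pd j Y)) y, N y⟫ + ⟪pd i (pd j Y) y, pd t N y⟫) := by
    filter_upwards [pd_congr ((P.secondForm_comm i j).trans (P.secondForm_eventually j i)) t,
      eventually_differentiableAt hT (by norm_num),
      eventually_differentiableAt hN (by norm_num)] with y h1 h2 h3
    rw [h1, pd_neg, pd_inner h2 h3]
  have d1 : DifferentiableAt ℝ (pd t (pd i (pd j Y))) p :=
    (contDiffAt_pd (m := 1) hT (by norm_num) t).differentiableAt (by norm_num)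
  have d2 : DifferentiableAt ℝ (pd t N) p :=
    (contDiffAt_pd (m := 2) hN (by norm_num) t).differentiableAt (by norm_num)
  have d3 := hT.differentiableAt (by norm_num)
  have d4 := hN.differentiableAt (by norm_num)
  have h5 : ⟪pd i (pd j Y) p, pd s (pd t N) p⟫ = secondForm Y N p i j *
      (secondForm Y N p * (metric Y p)⁻¹ * secondForm Y N p) s t := by
    rw [P.inner_eq, P.inner_pd_pd_normal_self, P.inner_pd_pd_normal, Finset.sum_eq_zero]
    · ring
    · intro a _
      exact Finset.sum_eq_zero fun b _ => by rw [P.inner_pd_pd_pd hg]; ring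
  rw [(pd_congr h1 s).self_of_nhds, pd_neg, pd_add (d1.inner ℝ d4) (d3.inner ℝ d2),
    pd_inner d1 d4, pd_inner d3 d2, P.inner_pd_normal_of_tangent _ s,
    P.inner_pd_normal_of_tangent _ t, h5]
  ring

/-- The products of second derivatives of `Y` reduce to products of entries of `h`, since those
derivatives are normal at `p`. The third-derivative terms remain: only `∂g`, not `∂∂g`, is
normalized. -/
theorem pd_pd_metric (P : HypersurfacePatch Y N p)
    (hg : ∀ s i j, pd s (fun y => metric Y y i j) p = 0) (s t i j : Fin n) :
    pd s (pd t (fun y => metric Y y i j)) p =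
      ⟪pd s (pd t (pd i Y)) p, pd j Y p⟫ + ⟪pd s (pd t (pd j Y)) p, pd i Y p⟫ +
      secondForm Y N p i s * secondForm Y N p j t +
      secondForm Y N p i t * secondForm Y N p j s := by
  have hT : ∀ a, ContDiffAt ℝ 3 (pd a Y) p := fun a =>
    contDiffAt_pd P.contDiffAt_param (by norm_num) a
  have hT2 : ∀ a b, ContDiffAt ℝ 2 (pd b (pd a Y)) p := fun a b =>
    contDiffAt_pd (hT a) (by norm_num) b
  have h1 : pd t (fun y => metric Y y i j) =ᶠ[𝓝 p]
      fun y => ⟪pd t (pd i Y) y, pd j Y y⟫ + ⟪pd i Y y, pd t (pd j Y) y⟫ := by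
    filter_upwards [eventually_differentiableAt (hT i) (by norm_num),
      eventually_differentiableAt (hT j) (by norm_num)] with y h1 h2
    exact pd_inner h1 h2 t
  have d1 := fun a => (hT a).differentiableAt (by norm_num)
  have d2 := fun a b => (hT2 a b).differentiableAt (by norm_num)
  have h5 : ∀ a b c d, ⟪pd a (pd b Y) p, pd c (pd d Y) p⟫ =
      secondForm Y N p b a * secondForm Y N p d c := by
    intro a b c d
    rw [P.inner_eq, P.inner_pd_pd_normal, P.inner_pd_pd_normal, Finset.sum_eq_zero,
      P.secondForm_symm a b, P.secondForm_symm c d]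
    · ring
    · intro a _
      exact Finset.sum_eq_zero fun b _ => by rw [P.inner_pd_pd_pd hg]; ring
  rw [(pd_congr h1 s).self_of_nhds, pd_add ((d2 i t).inner ℝ (d1 j)) ((d1 i).inner ℝ (d2 j t)),
    pd_inner (d2 i t) (d1 j), pd_inner (d1 i) (d2 j t), h5, h5,
    real_inner_comm (pd s (pd t (pd j Y)) p)]
  ring

theorem pd_support (P : HypersurfacePatch Y N p) (i : Fin n) :
    pd i (fun y => ⟪Y y, N y⟫) =ᶠ[𝓝 p] fun y => ⟪Y y, pd i N y⟫ := by
  filter_upwards [eventually_differentiableAt P.contDiffAt_param (by norm_num),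
    eventually_differentiableAt P.contDiffAt_normal (by norm_num), P.inner_pd_normal i]
    with y h1 h2 h3
  rw [pd_inner h1 h2, h3, zero_add]

/-- From `u_j = ⟨Y, ∂_j N⟩` one gets `u_ij = h_ij + ⟨Y, ∂_i∂_j N⟩`. The tangential part of `∂_i∂_j
N` is the gradient of `h_ij` by Codazzi; its normal part is `-(h g⁻¹ h)_ij` because `|N| = 1`. -/
theorem pd_pd_support (P : HypersurfacePatch Y N p)
    (hg : ∀ s i j, pd s (fun y => metric Y y i j) p = 0) (i j : Fin n) :
    pd i (pd j (fun y => ⟪Y y, N y⟫)) p =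
      (∑ a, ∑ b, (metric Y p)⁻¹ a b * ⟪Y p, pd a Y p⟫ *
        pd b (fun y => secondForm Y N y i j) p) + secondForm Y N p i j -
      ⟪Y p, N p⟫ * (secondForm Y N p * (metric Y p)⁻¹ * secondForm Y N p) i j := by
  have d1 := P.contDiffAt_param.differentiableAt (by norm_num)
  have d2 : ∀ a, DifferentiableAt ℝ (pd a N) p := fun a =>
    (contDiffAt_pd (m := 2) P.contDiffAt_normal (by norm_num) a).differentiableAt (by norm_num)
  have d3 : ∀ a, DifferentiableAt ℝ (pd a Y) p := fun a =>
    (contDiffAt_pd (m := 3) P.contDiffAt_param (by norm_num) a).differentiableAt (by norm_num)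
  have h2 : ∀ b, ⟪pd i (pd j N) p, pd b Y p⟫ = pd b (fun y => secondForm Y N y i j) p := by
    intro b
    rw [P.pd_secondForm_comm hg b i j]
    change _ = pd i (fun y => ⟪pd b Y y, pd j N y⟫) p
    rw [pd_inner (d3 b) (d2 j), P.inner_pd_pd_pd_normal hg, zero_add, real_inner_comm]
  have h3 : ⟪pd i Y p, pd j N p⟫ = secondForm Y N p i j := rfl
  rw [(pd_congr (P.pd_support j) i).self_of_nhds, pd_inner d1 (d2 j), P.inner_eq (Y p), h3,
    P.inner_pd_pd_normal_self]
  simp only [h2]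
  ring

end HypersurfacePatch

/-! ### Simons' identity as matrix algebra. -/

/-- The algebraic core of Simons' identity in coordinates with `∂g(p) = 0`: `ddh` and `ddg` are the
second derivatives of the two fundamental forms, `S` and `q` the normal components of the fourth and
the tangential components of the third derivatives of the parametrization. -/
theorem simons_algebraic {n : ℕ} {B h : Matrix (Fin n) (Fin n) ℝ} (hB : B.transpose = B)
    (hh : h.transpose = h) (S q : Fin n → Fin n → Fin n → Fin n → ℝ)
    (hS : ∀ i j k l, S i j k l = S k l i j) (hq : ∀ i j k c, q i j k c = q j i k c)
    (hq' : ∀ i j k c, q i j k c = q i k j c)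
    (ddh ddg : Fin n → Fin n → Matrix (Fin n) (Fin n) ℝ)
    (hddh : ∀ s t i j, ddh s t i j = -S s t i j - ∑ c, q t i j c * (B * h) c s
      - ∑ c, q s i j c * (B * h) c t - h i j * (h * B * h) s t)
    (hddg : ∀ s t i j, ddg s t i j = q s t i j + q s t j i + h i s * h j t + h i t * h j s) :
    ∃ X : Matrix (Fin n) (Fin n) ℝ,
      Matrix.of (fun i j => (B * (ddh i j - ddg i j * (B * h))).trace) =
        (∑ s, ∑ t, B s t • (ddh s t - ddg s t * (B * h))) + (X * (B * h) - h * B * X)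
        - (B * h).trace • (h * B * h) + (∑ s, ∑ t, B s t * (h * B * h) s t) • h := by
  have eB : ∀ a b, B a b = B b a := fun a b => congrFun (congrFun hB b) a
  have eh : ∀ a b, h a b = h b a := fun a b => congrFun (congrFun hh b) a
  have mA : ∀ (A A' : Matrix (Fin n) (Fin n) ℝ) i j, (A * A') i j = ∑ c, A i c * A' c j :=
    fun A A' i j => Matrix.mul_apply
  have tA : ∀ A A' : Matrix (Fin n) (Fin n) ℝ, (A * A').trace = ∑ a, ∑ b, A a b * A' b a :=
    fun A A' => Finset.sum_congr rfl fun a _ => mA A A' a a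
  set W := B * h with hW
  set K := h * B * h with hK
  set C := B * h * B with hC
  -- `R` collects the tangential components of the traced third derivatives of `Y`. They depend on
  -- the coordinates and survive only in the commutator-like term.
  set R : Matrix (Fin n) (Fin n) ℝ := Matrix.of fun i c => ∑ a, ∑ b, B a b * q i a b c with hR
  have eR : ∀ i c, R i c = ∑ a, ∑ b, B a b * q i a b c := fun i c => rfl
  have hRW : ∀ i j, ∑ a, ∑ b, B a b * ∑ c, q i a b c * W c j = (R * W) i j := by
    intro i j
    simp only [mA R W, eR, Finset.sum_mul, Finset.mul_sum]
    conv_rhs => rw [Finset.sum_comm]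
    refine Finset.sum_congr rfl fun a _ => ?_
    conv_rhs => rw [Finset.sum_comm]
    exact Finset.sum_congr rfl fun b _ => Finset.sum_congr rfl fun c _ => by ring
  have hWC : ∀ c t, ∑ s, W c s * B s t = C c t := fun c t => (mA _ _ _ _).symm
  have hqC : ∀ i j, ∑ s, ∑ t, B s t * ∑ c, q t i j c * W c s =
      ∑ t, ∑ c, q i j t c * C c t := by
    intro i j
    rw [Finset.sum_comm]
    refine Finset.sum_congr rfl fun t _ => ?_
    simp only [Finset.mul_sum, ← hWC]
    rw [Finset.sum_comm]
    refine Finset.sum_congr rfl fun c _ => Finset.sum_congr rfl fun s _ => ?_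
    rw [hq t i j c, hq' i t j c]; ring
  have hqC' : ∀ i j, ∑ s, ∑ t, B s t * ∑ c, q s i j c * W c t =
      ∑ t, ∑ c, q i j t c * C c t := by
    intro i j
    rw [← hqC, Finset.sum_comm]
    exact Finset.sum_congr rfl fun a _ => Finset.sum_congr rfl fun b _ => by rw [eB]
  have eC : ∀ a b, C a b = C b a := by
    have : C.transpose = C := by
      rw [hC, Matrix.transpose_mul, Matrix.transpose_mul, hB, hh, mul_assoc]
    exact fun a b => congrFun (congrFun this b) a
  have hhCh : ∀ i j, ∑ b, ∑ c, h i b * C b c * h c j = (h * C * h) i j := by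
    intro i j
    simp only [mA (h * C) h, mA h C, Finset.sum_mul]
    rw [Finset.sum_comm]
  -- `L1` and `L2` trace over the indices of the tensors, `L3` and `L4` over those of the
  -- derivatives. Pair symmetry of `S` and full symmetry of `q` in its first three indices match all
  -- terms except those in `R`, `W.trace` and `|A|²`.
  have L1 : ∀ i j, (B * ddh i j).trace =
      -(∑ a, ∑ b, B a b * S a b i j) - (R * W) j i - (R * W) i j - W.trace * K i j := by
    intro i j
    have h1 : (B * ddh i j).trace = ∑ a, ∑ b, B a b * ddh i j a b := by
      rw [tA, Finset.sum_comm]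
      exact Finset.sum_congr rfl fun a _ => Finset.sum_congr rfl fun b _ => by rw [eB]
    have h2 : W.trace = ∑ a, ∑ b, B a b * h a b := by
      rw [tA]
      exact Finset.sum_congr rfl fun a _ => Finset.sum_congr rfl fun b _ => by rw [eh]
    rw [h1, ← hRW, ← hRW, h2]
    simp only [hddh, mul_sub, Finset.sum_sub_distrib, mul_neg, Finset.sum_neg_distrib,
      Finset.sum_mul, hS i j, ← mul_assoc]
  have L2 : ∀ i j, (B * (ddg i j * W)).trace =
      2 * (∑ t, ∑ c, q i j t c * C c t) + 2 * (h * C * h) i j := by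
    intro i j
    have h1 : (B * (ddg i j * W)).trace = ∑ b, ∑ c, ddg i j b c * C c b := by
      rw [Matrix.trace_mul_comm, mul_assoc, ← hC, tA]
    rw [h1, ← hhCh]
    simp only [hddg, add_mul, Finset.sum_add_distrib]
    have h2 : ∑ b, ∑ c, q i j c b * C c b = ∑ t, ∑ c, q i j t c * C c t := by
      rw [Finset.sum_comm]
      exact Finset.sum_congr rfl fun a _ => Finset.sum_congr rfl fun b _ => by rw [eC]
    have h3 : ∑ b, ∑ c, h b i * h c j * C c b = ∑ b, ∑ c, h i b * C b c * h c j :=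
      Finset.sum_congr rfl fun b _ => Finset.sum_congr rfl fun c _ => by
        rw [eC c b, eh b i]; ring
    have h4 : ∑ b, ∑ c, h b j * h c i * C c b = ∑ b, ∑ c, h i b * C b c * h c j := by
      rw [Finset.sum_comm]
      exact Finset.sum_congr rfl fun b _ => Finset.sum_congr rfl fun c _ => by
        rw [eh b i]; ring
    rw [h2, h3, h4]; ring
  have L3 : ∀ i j, ∑ s, ∑ t, B s t * ddh s t i j = -(∑ a, ∑ b, B a b * S a b i j)
      - 2 * (∑ t, ∑ c, q i j t c * C c t) - (∑ s, ∑ t, B s t * K s t) * h i j := by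
    intro i j
    simp only [hddh, mul_sub, Finset.sum_sub_distrib, mul_neg, Finset.sum_neg_distrib]
    rw [hqC, hqC']
    have h1 : ∑ s, ∑ t, B s t * (h i j * K s t) = (∑ s, ∑ t, B s t * K s t) * h i j := by
      simp only [Finset.sum_mul]
      exact Finset.sum_congr rfl fun b _ => Finset.sum_congr rfl fun c _ => by ring
    rw [h1]; ring
  have L4 : ∑ s, ∑ t, B s t • (ddg s t * W) = (R + R.transpose + (2 : ℝ) • K) * W := by
    have h1 : ∑ s, ∑ t, B s t • ddg s t = R + R.transpose + (2 : ℝ) • K := by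
      ext i m
      have hKim : ∀ i m, ∑ s, ∑ t, B s t * (h i s * h m t) = K i m := by
        intro i m
        rw [hK]
        simp only [mA (h * B) h, mA h B, Finset.sum_mul]
        rw [Finset.sum_comm]
        exact Finset.sum_congr rfl fun b _ => Finset.sum_congr rfl fun c _ => by
          rw [eh m]; ring
      have hKim' : ∑ s, ∑ t, B s t * (h i t * h m s) = K i m := by
        rw [← hKim, Finset.sum_comm]
        exact Finset.sum_congr rfl fun b _ => Finset.sum_congr rfl fun c _ => by rw [eB]
      have hRim : ∀ i m, ∑ s, ∑ t, B s t * q s t i m = R i m := by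
        intro i m
        rw [eR]
        exact Finset.sum_congr rfl fun b _ => Finset.sum_congr rfl fun c _ => by
          rw [hq' b c i m, hq b i c m]
      simp only [Matrix.sum_apply, Matrix.smul_apply, Matrix.add_apply, Matrix.transpose_apply,
        smul_eq_mul, hddg, mul_add, Finset.sum_add_distrib, hKim, hKim', hRim]
      ring
    rw [← h1]
    simp only [Finset.sum_mul, Matrix.smul_mul]
  have hKW : K * W = h * C * h := by simp only [hK, hW, hC, mul_assoc]
  have hRt : ∀ i j, (h * B * R.transpose) i j = (R * W) j i := by
    intro i j
    have : (h * B * R.transpose).transpose = R * W := by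
      rw [Matrix.transpose_mul, Matrix.transpose_mul, hB, hh, Matrix.transpose_transpose]
    exact congrFun (congrFun this j) i
  -- The unmatched part is `RᵀW - (RW)ᵀ`, and `(RW)ᵀ = h B Rᵀ`.
  refine ⟨R.transpose, ?_⟩
  ext i j
  have L3' : (∑ s, ∑ t, B s t • ddh s t) i j = ∑ s, ∑ t, B s t * ddh s t i j := by
    simp [Matrix.sum_apply]
  simp only [smul_sub, Finset.sum_sub_distrib, L4]
  simp only [Matrix.of_apply, mul_sub, Matrix.trace_sub, L1, L2, Matrix.add_apply,
    Matrix.sub_apply, L3', L3, hRt, Matrix.smul_apply, add_mul, Matrix.smul_mul, hKW, smul_eq_mul]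
  ring

/-! ### Derivatives of `H`, `F` and `u`, and the identity in coordinates with `∂g(p) = 0`. -/

section

variable {n : ℕ}

/-- Entrywise partial derivative of a matrix-valued function. -/
def pdMat (s : Fin n) (G : E n → Matrix (Fin n) (Fin n) ℝ) (y : E n) :
    Matrix (Fin n) (Fin n) ℝ := Matrix.of fun i j => pd s (fun z => G z i j) y

/-- Entrywise second partial derivative of a matrix-valued function. -/
def pdPdMat (s t : Fin n) (G : E n → Matrix (Fin n) (Fin n) ℝ) (y : E n) :
    Matrix (Fin n) (Fin n) ℝ := Matrix.of fun i j => pd s (pd t (fun z => G z i j)) y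

namespace HypersurfacePatch

variable {Y N : E n → E (n + 1)} {p : E n}

theorem eventually_metric_mul_shape (P : HypersurfacePatch Y N p) :
    ∀ᶠ y in 𝓝 p, metric Y y * ((metric Y y)⁻¹ * secondForm Y N y) = secondForm Y N y := by
  have hc : ContinuousAt (fun y => (metric Y y).det) p :=
    (contDiffAt_det P.contDiffAt_metric).continuousAt
  filter_upwards [hc.eventually_ne P.isUnit_det_metric.ne_zero] with y hy
  exact Matrix.mul_nonsing_inv_cancel_left _ _ (isUnit_iff_ne_zero.2 hy)

theorem metric_mul_shape_apply (P : HypersurfacePatch Y N p) (i j : Fin n) :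
    (fun y => secondForm Y N y i j) =ᶠ[𝓝 p]
      fun y => ∑ m, metric Y y i m * ((metric Y y)⁻¹ * secondForm Y N y) m j := by
  filter_upwards [P.eventually_metric_mul_shape] with y hy
  rw [← Matrix.mul_apply, hy]

/-- Differentiating `gW = h` avoids the derivative of the inverse matrix; the term with `∂g`
vanishes. -/
theorem pdMat_shape (P : HypersurfacePatch Y N p)
    (hg : ∀ s i j, pd s (fun y => metric Y y i j) p = 0) (s : Fin n) :
    pdMat s (fun y => (metric Y y)⁻¹ * secondForm Y N y) p =
      (metric Y p)⁻¹ * pdMat s (secondForm Y N) p := by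
  have h1 : metric Y p * pdMat s (fun y => (metric Y y)⁻¹ * secondForm Y N y) p =
      pdMat s (secondForm Y N) p := by
    ext i j
    have d1 : ∀ a b, DifferentiableAt ℝ (fun y => metric Y y a b) p := fun a b =>
      (P.contDiffAt_metric a b).differentiableAt (by norm_num)
    have d2 : ∀ a b, DifferentiableAt ℝ
        (fun y => ((metric Y y)⁻¹ * secondForm Y N y) a b) p := fun a b =>
      (P.contDiffAt_shape a b).differentiableAt (by norm_num)
    rw [Matrix.mul_apply]
    simp only [pdMat, Matrix.of_apply]
    rw [(pd_congr (P.metric_mul_shape_apply i j) s).self_of_nhds,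
      pd_sum fun m _ => (d1 i m).fun_mul (d2 m j)]
    refine Finset.sum_congr rfl fun m _ => ?_
    rw [pd_mul (d1 i m) (d2 m j), hg, zero_mul, zero_add]
  rw [← h1, Matrix.nonsing_inv_mul_cancel_left _ _ P.isUnit_det_metric]

/-- Second derivative of `gW = h`: the cross terms contain `∂g(p) = 0`, but `∂∂g` contributes. -/
theorem pdPdMat_shape (P : HypersurfacePatch Y N p)
    (hg : ∀ s i j, pd s (fun y => metric Y y i j) p = 0) (s t : Fin n) :
    pdPdMat s t (fun y => (metric Y y)⁻¹ * secondForm Y N y) p =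
      (metric Y p)⁻¹ * (pdPdMat s t (secondForm Y N) p -
        pdPdMat s t (metric Y) p * ((metric Y p)⁻¹ * secondForm Y N p)) := by
  have h1 : pdPdMat s t (metric Y) p * ((metric Y p)⁻¹ * secondForm Y N p) +
      metric Y p * pdPdMat s t (fun y => (metric Y y)⁻¹ * secondForm Y N y) p =
      pdPdMat s t (secondForm Y N) p := by
    ext i j
    have c1 : ∀ a b, ContDiffAt ℝ 2 (fun y => metric Y y a b) p := fun a b =>
      (P.contDiffAt_metric a b).of_le (by norm_num)
    have c3 : ∀ m, ContDiffAt ℝ 2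
        (fun y => metric Y y i m * ((metric Y y)⁻¹ * secondForm Y N y) m j) p := fun m =>
      (c1 i m).mul (P.contDiffAt_shape m j)
    have h2 : pd t (fun y => ∑ m, metric Y y i m * ((metric Y y)⁻¹ * secondForm Y N y) m j)
        =ᶠ[𝓝 p] fun y => ∑ m, pd t (fun y => metric Y y i m *
          ((metric Y y)⁻¹ * secondForm Y N y) m j) y := by
      have hev : ∀ᶠ y in 𝓝 p, ∀ m, DifferentiableAt ℝ
          (fun y => metric Y y i m * ((metric Y y)⁻¹ * secondForm Y N y) m j) y := by
        rw [eventually_all]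
        exact fun m => eventually_differentiableAt (c3 m) (by norm_num)
      filter_upwards [hev] with y hy
      exact pd_sum (fun m _ => hy m) t
    rw [Matrix.add_apply, Matrix.mul_apply, Matrix.mul_apply, ← Finset.sum_add_distrib]
    simp only [pdPdMat, Matrix.of_apply]
    rw [(pd_congr ((pd_congr (P.metric_mul_shape_apply i j) t).trans h2) s).self_of_nhds,
      pd_sum fun m _ => (contDiffAt_pd (m := 1) (c3 m) (by norm_num) t).differentiableAt
        (by norm_num)]
    refine Finset.sum_congr rfl fun m _ => ?_
    rw [pd_pd_mul (c1 i m) (P.contDiffAt_shape m j), hg, hg, zero_mul, zero_mul]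
    ring
  rw [← h1, add_sub_cancel_left, Matrix.nonsing_inv_mul_cancel_left _ _ P.isUnit_det_metric]

theorem sigmaForm_eq_evalMat (k : ℕ) :
    (fun y => sigmaForm k (metric Y y) (secondForm Y N y)) =
      fun y => evalMat (sigmaPoly n k) ((metric Y y)⁻¹ * secondForm Y N y) := by
  funext y
  rw [sigmaForm, sigma_eq_evalMat]

theorem contDiffAt_sigmaForm (P : HypersurfacePatch Y N p) (k : ℕ) :
    ContDiffAt ℝ 2 (fun y => sigmaForm k (metric Y y) (secondForm Y N y)) p := by
  rw [sigmaForm_eq_evalMat]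
  exact contDiffAt_evalMat _ P.contDiffAt_shape

theorem pd_sigmaForm (P : HypersurfacePatch Y N p)
    (hg : ∀ s i j, pd s (fun y => metric Y y i j) p = 0) (k : ℕ) (s : Fin n) :
    pd s (fun y => sigmaForm k (metric Y y) (secondForm Y N y)) p =
      dEval (sigmaPoly n k) ((metric Y p)⁻¹ * secondForm Y N p)
        ((metric Y p)⁻¹ * pdMat s (secondForm Y N) p) := by
  rw [sigmaForm_eq_evalMat, pd_evalMat _
    fun i j => (P.contDiffAt_shape i j).differentiableAt (by norm_num), ← P.pdMat_shape hg]
  rfl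

theorem pd_pd_sigmaForm (P : HypersurfacePatch Y N p)
    (hg : ∀ s i j, pd s (fun y => metric Y y i j) p = 0) (k : ℕ) (s t : Fin n) :
    pd s (pd t (fun y => sigmaForm k (metric Y y) (secondForm Y N y))) p =
      ddEval (sigmaPoly n k) ((metric Y p)⁻¹ * secondForm Y N p)
        ((metric Y p)⁻¹ * pdMat t (secondForm Y N) p)
        ((metric Y p)⁻¹ * pdMat s (secondForm Y N) p) +
      dEval (sigmaPoly n k) ((metric Y p)⁻¹ * secondForm Y N p)
        ((metric Y p)⁻¹ * (pdPdMat s t (secondForm Y N) p -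
        pdPdMat s t (metric Y) p * ((metric Y p)⁻¹ * secondForm Y N p))) := by
  rw [sigmaForm_eq_evalMat, pd_pd_evalMat _ P.contDiffAt_shape, ← P.pdMat_shape hg,
    ← P.pdMat_shape hg, ← P.pdPdMat_shape hg]
  rfl

/-- `σ_1` is the trace, linear in `W`, so no second derivative of the polynomial appears. -/
theorem pd_pd_meanCurvature (P : HypersurfacePatch Y N p) (hn : 1 ≤ n)
    (hg : ∀ s i j, pd s (fun y => metric Y y i j) p = 0) (s t : Fin n) :
    pd s (pd t (fun y => sigmaForm 1 (metric Y y) (secondForm Y N y))) p =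
      ((metric Y p)⁻¹ * (pdPdMat s t (secondForm Y N) p -
        pdPdMat s t (metric Y) p * ((metric Y p)⁻¹ * secondForm Y N p))).trace := by
  have h1 : (fun y => sigmaForm 1 (metric Y y) (secondForm Y N y)) =
      fun y => ∑ a, ((metric Y y)⁻¹ * secondForm Y N y) a a := by
    funext y
    rw [sigmaForm, sigma_one hn]; rfl
  have h2 : pd t (fun y => ∑ a, ((metric Y y)⁻¹ * secondForm Y N y) a a) =ᶠ[𝓝 p]
      fun y => ∑ a, pd t (fun z => ((metric Y z)⁻¹ * secondForm Y N z) a a) y := by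
    have hev : ∀ᶠ y in 𝓝 p, ∀ a, DifferentiableAt ℝ
        (fun z => ((metric Y z)⁻¹ * secondForm Y N z) a a) y := by
      rw [eventually_all]
      exact fun a => eventually_differentiableAt (P.contDiffAt_shape a a) (by norm_num)
    filter_upwards [hev] with y hy
    exact pd_sum (fun a _ => hy a) t
  rw [h1, (pd_congr h2 s).self_of_nhds, pd_sum fun a _ =>
    (contDiffAt_pd (m := 1) (P.contDiffAt_shape a a) (by norm_num) t).differentiableAt
      (by norm_num), ← P.pdPdMat_shape hg]
  rfl

/-- Simons' identity in coordinates with `∂g(p) = 0`, contracted with `∂σ_k/∂h`. -/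
theorem dEval_hess_meanCurvature (P : HypersurfacePatch Y N p) (hn : 1 ≤ n)
    (hg : ∀ s i j, pd s (fun y => metric Y y i j) p = 0) {k : ℕ} (hk : k ≤ n) :
    dEval (sigmaPoly n k) ((metric Y p)⁻¹ * secondForm Y N p) ((metric Y p)⁻¹ *
      Matrix.of fun i j => pd i (pd j
        (fun y => sigmaForm 1 (metric Y y) (secondForm Y N y))) p) =
    (∑ s, ∑ t, (metric Y p)⁻¹ s t *
      (pd s (pd t (fun y => sigmaForm k (metric Y y) (secondForm Y N y))) p -
      ddEval (sigmaPoly n k) ((metric Y p)⁻¹ * secondForm Y N p)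
        ((metric Y p)⁻¹ * pdMat t (secondForm Y N) p)
        ((metric Y p)⁻¹ * pdMat s (secondForm Y N) p)))
    - sigmaForm 1 (metric Y p) (secondForm Y N p) *
      dEval (sigmaPoly n k) ((metric Y p)⁻¹ * secondForm Y N p) ((metric Y p)⁻¹ *
        (secondForm Y N p * (metric Y p)⁻¹ * secondForm Y N p))
    + (∑ s, ∑ t, (metric Y p)⁻¹ s t *
        (secondForm Y N p * (metric Y p)⁻¹ * secondForm Y N p) s t) *
      (k * sigmaForm k (metric Y p) (secondForm Y N p)) := by
  set B := (metric Y p)⁻¹ with hB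
  set h := secondForm Y N p with hh
  have hBt : B.transpose = B := by
    rw [hB, Matrix.transpose_nonsing_inv, transpose_metric]
  have hht : h.transpose = h := P.transpose_secondForm
  obtain ⟨X, hX⟩ := simons_algebraic hBt hht
    (fun i j k l => ⟪pd i (pd j (pd k (pd l Y))) p, N p⟫)
    (fun i j k c => ⟪pd i (pd j (pd k Y)) p, pd c Y p⟫)
    (fun i j k l => by rw [P.pd_pd_pd_pd_comm])
    (fun i j k c => by rw [(P.pd_pd_pd_comm i j k).1.self_of_nhds])
    (fun i j k c => by rw [(P.pd_pd_pd_comm i j k).2.self_of_nhds])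
    (fun s t => pdPdMat s t (secondForm Y N) p) (fun s t => pdPdMat s t (metric Y) p)
    (fun s t i j => P.pd_pd_secondForm hg s t i j) (fun s t i j => P.pd_pd_metric hg s t i j)
  have hH : (Matrix.of fun i j => pd i (pd j
      (fun y => sigmaForm 1 (metric Y y) (secondForm Y N y))) p) =
      Matrix.of fun i j => (B * (pdPdMat i j (secondForm Y N) p -
        pdPdMat i j (metric Y) p * (B * h))).trace := by
    ext i j
    exact P.pd_pd_meanCurvature hn hg i j
  -- With `M = B X` and `A = B h`, the two arguments are `M A` and `A M`.
  have hcomm : dEval (sigmaPoly n k) (B * h) (B * (X * (B * h))) =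
      dEval (sigmaPoly n k) (B * h) (B * (h * B * X)) := by
    rw [← mul_assoc, dEval_sigmaPoly_mul_comm]
    simp only [mul_assoc]
  have htr : sigmaForm 1 (metric Y p) h = (B * h).trace := by rw [sigmaForm, sigma_one hn]
  have hF : ∀ s t, pd s (pd t (fun y => sigmaForm k (metric Y y) (secondForm Y N y))) p -
      ddEval (sigmaPoly n k) (B * h) (B * pdMat t (secondForm Y N) p)
        (B * pdMat s (secondForm Y N) p) = dEval (sigmaPoly n k) (B * h)
          (B * (pdPdMat s t (secondForm Y N) p - pdPdMat s t (metric Y) p * (B * h))) := by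
    intro s t
    rw [P.pd_pd_sigmaForm hg, add_sub_cancel_left]
  have hEuler : dEval (sigmaPoly n k) (B * h) (B * h) = k * sigmaForm k (metric Y p) h :=
    dEval_sigmaPoly_self hk _
  rw [hH, hX, htr, ← hEuler]
  simp only [hF, mul_add, mul_sub, map_add, map_sub, Finset.mul_sum, Matrix.mul_smul, map_sum,
    map_smul, smul_eq_mul, hcomm]
  ring

theorem dEval_hess_support (P : HypersurfacePatch Y N p)
    (hg : ∀ s i j, pd s (fun y => metric Y y i j) p = 0) {k : ℕ} (hk : k ≤ n) :
    dEval (sigmaPoly n k) ((metric Y p)⁻¹ * secondForm Y N p) ((metric Y p)⁻¹ *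
      Matrix.of fun i j => pd i (pd j (fun y => ⟪Y y, N y⟫)) p) =
    (∑ a, ∑ b, (metric Y p)⁻¹ a b * ⟪Y p, pd a Y p⟫ *
      pd b (fun y => sigmaForm k (metric Y y) (secondForm Y N y)) p)
    + k * sigmaForm k (metric Y p) (secondForm Y N p)
    - ⟪Y p, N p⟫ * dEval (sigmaPoly n k) ((metric Y p)⁻¹ * secondForm Y N p) ((metric Y p)⁻¹ *
        (secondForm Y N p * (metric Y p)⁻¹ * secondForm Y N p)) := by
  have h1 : (Matrix.of fun i j => pd i (pd j (fun y => ⟪Y y, N y⟫)) p) =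
      (∑ a, ∑ b, ((metric Y p)⁻¹ a b * ⟪Y p, pd a Y p⟫) • pdMat b (secondForm Y N) p)
      + secondForm Y N p - ⟪Y p, N p⟫ •
        (secondForm Y N p * (metric Y p)⁻¹ * secondForm Y N p) := by
    ext i j
    rw [Matrix.of_apply, P.pd_pd_support hg]
    simp [Matrix.sum_apply, pdMat]
  have hEuler : dEval (sigmaPoly n k) ((metric Y p)⁻¹ * secondForm Y N p)
      ((metric Y p)⁻¹ * secondForm Y N p) = k * sigmaForm k (metric Y p) (secondForm Y N p) :=
    dEval_sigmaPoly_self hk _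
  rw [h1]
  simp only [P.pd_sigmaForm hg, mul_add, mul_sub, map_add, map_sub, Finset.mul_sum,
    Matrix.mul_smul, map_sum, map_smul, smul_eq_mul, hEuler]

theorem trace_hess_support (P : HypersurfacePatch Y N p) (hn : 1 ≤ n)
    (hg : ∀ s i j, pd s (fun y => metric Y y i j) p = 0) :
    ∑ s, ∑ t, (metric Y p)⁻¹ s t * pd s (pd t (fun y => ⟪Y y, N y⟫)) p =
    (∑ a, ∑ b, (metric Y p)⁻¹ a b * ⟪Y p, pd a Y p⟫ *
      pd b (fun y => sigmaForm 1 (metric Y y) (secondForm Y N y)) p)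
    + sigmaForm 1 (metric Y p) (secondForm Y N p)
    - ⟪Y p, N p⟫ * ∑ s, ∑ t, (metric Y p)⁻¹ s t *
        (secondForm Y N p * (metric Y p)⁻¹ * secondForm Y N p) s t := by
  have htr : ∀ A M : Matrix (Fin n) (Fin n) ℝ, dEval (sigmaPoly n 1) A M = M.trace := by
    intro A M
    refine (hasDerivAt_evalMat_line (sigmaPoly n 1) A M).unique ?_
    have h1 : (fun t : ℝ => evalMat (sigmaPoly n 1) (A + t • M)) =
        fun t : ℝ => A.trace + t * M.trace := by
      funext t
      rw [← sigma_eq_evalMat, sigma_one hn, Matrix.trace_add, Matrix.trace_smul, smul_eq_mul]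
    rw [h1]
    simpa using ((hasDerivAt_id (0 : ℝ)).mul_const M.trace).const_add A.trace
  have hB : ∀ a b, (metric Y p)⁻¹ a b = (metric Y p)⁻¹ b a := by
    have : (metric Y p)⁻¹.transpose = (metric Y p)⁻¹ := by
      rw [Matrix.transpose_nonsing_inv, transpose_metric]
    exact fun a b => congrFun (congrFun this b) a
  have htm : ∀ M : Matrix (Fin n) (Fin n) ℝ, ((metric Y p)⁻¹ * M).trace =
      ∑ s, ∑ t, (metric Y p)⁻¹ s t * M s t := by
    intro M
    have h1 : ((metric Y p)⁻¹ * M).trace = ∑ s, ∑ t, (metric Y p)⁻¹ s t * M t s :=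
      Finset.sum_congr rfl fun a _ => Matrix.mul_apply
    rw [h1, Finset.sum_comm]
    exact Finset.sum_congr rfl fun a _ => Finset.sum_congr rfl fun b _ => by rw [hB]
  -- The case `k = 1`, where `dσ_1` is the trace.
  have h := P.dEval_hess_support hg hn
  rw [htr, htr, htm, htm, Nat.cast_one, one_mul] at h
  exact h

/-- The identity at a critical point of `H / u`, in coordinates with `∂g(p) = 0`. -/
theorem hess_meanCurvature_div_support (P : HypersurfacePatch Y N p)
    (hg : ∀ s i j, pd s (fun y => metric Y y i j) p = 0) {k : ℕ} (hn : 1 ≤ n) (hk : k ≤ n)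
    {u H ϕ : E n → ℝ} (hu : u = fun y => ⟪Y y, N y⟫) (hup : u p ≠ 0)
    (hH : H =ᶠ[𝓝 p] fun y => sigmaForm 1 (metric Y y) (secondForm Y N y))
    (hF : (fun y => sigmaForm k (metric Y y) (secondForm Y N y)) =ᶠ[𝓝 p] fun y => ϕ y * u y)
    (hcrit : ∀ i, pd i (fun y => H y / u y) p = 0) :
    ∑ i, ∑ j, dF k (metric Y p) (secondForm Y N p) i j *
        pd i (pd j (fun y => H y / u y)) p
      = (1 / u p) * (∑ s, ∑ t, (metric Y p)⁻¹ s t *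
            (pd s (pd t ϕ) p * u p + 2 * pd s ϕ p * pd t u p))
        - (H p / u p) * (∑ l, ∑ m, (metric Y p)⁻¹ l m * (pd l ϕ p * ⟪Y p, pd m Y p⟫))
        - ((k : ℝ) - 1) * (H p / u p) * ϕ p
        + ((k : ℝ) - 1) * ϕ p *
            (∑ i, ∑ j, ∑ a, ∑ b, (metric Y p)⁻¹ i a * (metric Y p)⁻¹ j b *
              (secondForm Y N p i j * secondForm Y N p a b))
        - (1 / u p) * (∑ s, ∑ t, (metric Y p)⁻¹ s t * ∑ i, ∑ j, ∑ m, ∑ l,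
            ddF k (metric Y p) (secondForm Y N p) i j m l *
              pd s (fun y => secondForm Y N y i j) p *
              pd t (fun y => secondForm Y N y m l) p) := by
  set B := (metric Y p)⁻¹ with hBdef
  set h := secondForm Y N p with hh
  set K := h * B * h with hK
  have eB : ∀ a b, B a b = B b a := by
    have : B.transpose = B := by
      rw [hBdef, Matrix.transpose_nonsing_inv, transpose_metric]
    exact fun a b => congrFun (congrFun this b) a
  have hu3 : ContDiffAt ℝ 2 u p := by
    rw [hu]; exact P.contDiffAt_support.of_le (by norm_num)
  have hune : ∀ᶠ y in 𝓝 p, u y ≠ 0 := hu3.continuousAt.eventually_ne hup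
  have hH2 : ContDiffAt ℝ 2 H p := (P.contDiffAt_sigmaForm 1).congr_of_eventuallyEq hH
  have hQ2 : ContDiffAt ℝ 2 (fun y => H y / u y) p := hH2.div hu3 hup
  have hF2 := P.contDiffAt_sigmaForm k
  have hϕ2 : ContDiffAt ℝ 2 ϕ p := by
    refine (hF2.div hu3 hup).congr_of_eventuallyEq ?_
    filter_upwards [hF, hune] with y h1 h2
    rw [Pi.div_apply, h1, mul_div_cancel_right₀ _ h2]
  -- Working with the product `H = Q u` avoids the quotient rule; each first derivative of `Q` drops
  -- out at `p`.
  have hHQ : H =ᶠ[𝓝 p] fun y => (H y / u y) * u y := by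
    filter_upwards [hune] with y hy
    rw [div_mul_cancel₀ _ hy]
  have eH1 : ∀ i, pd i H p = H p / u p * pd i u p := by
    intro i
    rw [(pd_congr hHQ i).self_of_nhds, pd_mul (hQ2.differentiableAt (by norm_num))
      (hu3.differentiableAt (by norm_num)), hcrit]
    ring
  have eH2 : ∀ i j, pd i (pd j H) p =
      pd i (pd j (fun y => H y / u y)) p * u p + H p / u p * pd i (pd j u) p := by
    intro i j
    rw [(pd_congr (pd_congr hHQ j) i).self_of_nhds, pd_pd_mul hQ2 hu3, hcrit, hcrit]
    ring
  have eF0 : sigmaForm k (metric Y p) h = ϕ p * u p := hF.self_of_nhds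
  have eF1 : ∀ i, pd i (fun y => sigmaForm k (metric Y y) (secondForm Y N y)) p =
      pd i ϕ p * u p + ϕ p * pd i u p := by
    intro i
    rw [(pd_congr hF i).self_of_nhds, pd_mul (hϕ2.differentiableAt (by norm_num))
      (hu3.differentiableAt (by norm_num))]
  have eF2 : ∀ i j, pd i (pd j (fun y => sigmaForm k (metric Y y) (secondForm Y N y))) p =
      pd i (pd j ϕ) p * u p + pd j ϕ p * pd i u p +
        (pd i ϕ p * pd j u p + ϕ p * pd i (pd j u) p) := by
    intro i j
    rw [(pd_congr (pd_congr hF j) i).self_of_nhds, pd_pd_mul hϕ2 hu3]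
  have eHp : H p = sigmaForm 1 (metric Y p) h := hH.self_of_nhds
  have eHpd : ∀ i, pd i (fun y => sigmaForm 1 (metric Y y) (secondForm Y N y)) p = pd i H p :=
    fun i => (pd_congr hH i).self_of_nhds.symm
  have eHpd2 : ∀ i j, pd i (pd j (fun y => sigmaForm 1 (metric Y y) (secondForm Y N y))) p =
      pd i (pd j H) p := fun i j => (pd_congr (pd_congr hH j) i).self_of_nhds.symm
  have R1 := P.dEval_hess_meanCurvature hn hg hk
  have R2 := P.dEval_hess_support hg hk
  have R3 := P.trace_hess_support hn hg
  rw [← hu] at R2 R3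
  simp only [eHpd2, ← hBdef, ← hh, ← hK, ← eHp, eF0] at R1
  simp only [eF1, ← hBdef, ← hh, ← hK, eF0] at R2
  simp only [eHpd, ← hBdef, ← hh, ← hK, ← eHp] at R3
  have eup : ⟪Y p, N p⟫ = u p := by rw [hu]
  rw [eup] at R2 R3
  set L := dEval (sigmaPoly n k) (B * h) with hL
  set A2 := ∑ s, ∑ t, B s t * K s t with hA2
  have hA : ∑ i, ∑ j, ∑ a, ∑ b, B i a * B j b * (h i j * h a b) = A2 := by
    have e1 : ∀ i a, ∑ j, ∑ b, B j b * (h i j * h a b) = K i a := by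
      intro i a
      have mA : ∀ (A A' : Matrix (Fin n) (Fin n) ℝ) i j, (A * A') i j = ∑ c, A i c * A' c j :=
        fun A A' i j => Matrix.mul_apply
      rw [hK, mA (h * B) h]
      simp only [mA h B, Finset.sum_mul]
      rw [Finset.sum_comm]
      exact Finset.sum_congr rfl fun b _ => Finset.sum_congr rfl fun c _ => by
        rw [show h a b = h b a from P.secondForm_symm a b]; ring
    rw [hA2]
    refine Finset.sum_congr rfl fun i _ => ?_
    rw [Finset.sum_comm]
    refine Finset.sum_congr rfl fun a _ => ?_
    rw [← e1, Finset.mul_sum]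
    refine Finset.sum_congr rfl fun j _ => ?_
    rw [Finset.mul_sum]
    exact Finset.sum_congr rfl fun b _ => by ring
  have hdd : ∀ s t, ∑ i, ∑ j, ∑ m, ∑ l, ddF k (metric Y p) h i j m l *
      pd s (fun y => secondForm Y N y i j) p * pd t (fun y => secondForm Y N y m l) p =
      ddEval (sigmaPoly n k) (B * h) (B * pdMat s (secondForm Y N) p)
        (B * pdMat t (secondForm Y N) p) := fun s t =>
    sum_ddF_mul k (metric Y p) h (pdMat s (secondForm Y N) p) (pdMat t (secondForm Y N) p)
  have hLHS : ∑ i, ∑ j, dF k (metric Y p) h i j * pd i (pd j (fun y => H y / u y)) p =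
      L (B * Matrix.of fun i j => pd i (pd j (fun y => H y / u y)) p) :=
    sum_dF_mul k (metric Y p) h (Matrix.of fun i j => pd i (pd j (fun y => H y / u y)) p)
  have hHess : (Matrix.of fun i j => pd i (pd j H) p) =
      u p • (Matrix.of fun i j => pd i (pd j (fun y => H y / u y)) p) +
      (H p / u p) • Matrix.of fun i j => pd i (pd j u) p := by
    ext i j
    simp only [Matrix.add_apply, Matrix.smul_apply, Matrix.of_apply, smul_eq_mul, eH2]
    ring
  rw [hHess, mul_add, Matrix.mul_smul, Matrix.mul_smul, map_add, map_smul, map_smul, smul_eq_mul,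
    smul_eq_mul, R2] at R1
  rw [hLHS, hA]
  simp only [hdd]
  simp only [eF2] at R1
  set D := ∑ s, ∑ t, B s t * ddEval (sigmaPoly n k) (B * h) (B * pdMat s (secondForm Y N) p)
    (B * pdMat t (secondForm Y N) p) with hD
  -- Simons' identity yields the two derivative slots in the opposite order; symmetry of `B`
  -- suffices to exchange them.
  have hD' : ∑ s, ∑ t, B s t * ddEval (sigmaPoly n k) (B * h) (B * pdMat t (secondForm Y N) p)
      (B * pdMat s (secondForm Y N) p) = D := by
    rw [hD, Finset.sum_comm]
    exact Finset.sum_congr rfl fun b _ => Finset.sum_congr rfl fun c _ => by rw [eB]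
  set Φ2 := ∑ s, ∑ t, B s t * (pd s (pd t ϕ) p * u p + 2 * pd s ϕ p * pd t u p) with hΦ2
  set UU := ∑ s, ∑ t, B s t * pd s (pd t u) p with hUU
  have hsplit : ∑ s, ∑ t, B s t * (pd s (pd t ϕ) p * u p + pd t ϕ p * pd s u p +
        (pd s ϕ p * pd t u p + ϕ p * pd s (pd t u) p) -
        ddEval (sigmaPoly n k) (B * h) (B * pdMat t (secondForm Y N) p)
          (B * pdMat s (secondForm Y N) p)) = Φ2 + ϕ p * UU - D := by
    have e1 : ∑ s, ∑ t, B s t * (pd t ϕ p * pd s u p) =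
        ∑ s, ∑ t, B s t * (pd s ϕ p * pd t u p) := by
      rw [Finset.sum_comm]
      exact Finset.sum_congr rfl fun b _ => Finset.sum_congr rfl fun c _ => by rw [eB]
    rw [← hD', hΦ2, hUU]
    simp only [mul_add, mul_sub, Finset.sum_add_distrib, Finset.sum_sub_distrib, e1]
    have e2 : ∑ s, ∑ t, B s t * (2 * pd s ϕ p * pd t u p) =
        2 * ∑ s, ∑ t, B s t * (pd s ϕ p * pd t u p) := by
      simp only [Finset.mul_sum]
      exact Finset.sum_congr rfl fun b _ => Finset.sum_congr rfl fun c _ => by ring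
    have e3 : ∑ s, ∑ t, B s t * (ϕ p * pd s (pd t u) p) =
        ϕ p * ∑ s, ∑ t, B s t * pd s (pd t u) p := by
      simp only [Finset.mul_sum]
      exact Finset.sum_congr rfl fun b _ => Finset.sum_congr rfl fun c _ => by ring
    rw [e2, e3]; ring
  rw [hsplit, R3] at R1
  set XU := ∑ a, ∑ b, B a b * ⟪Y p, pd a Y p⟫ * pd b u p with hXU
  set XΦ := ∑ l, ∑ m, B l m * (pd l ϕ p * ⟪Y p, pd m Y p⟫) with hXΦ
  have g1 : ∑ a, ∑ b, B a b * ⟪Y p, pd a Y p⟫ * pd b H p = H p / u p * XU := by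
    simp only [hXU, eH1, Finset.mul_sum]
    exact Finset.sum_congr rfl fun b _ => Finset.sum_congr rfl fun c _ => by ring
  have g2 : ∑ a, ∑ b, B a b * ⟪Y p, pd a Y p⟫ * (pd b ϕ p * u p + ϕ p * pd b u p) =
      u p * XΦ + ϕ p * XU := by
    have e1 : XΦ = ∑ a, ∑ b, B a b * (pd b ϕ p * ⟪Y p, pd a Y p⟫) := by
      rw [hXΦ, Finset.sum_comm]
      exact Finset.sum_congr rfl fun b _ => Finset.sum_congr rfl fun c _ => by rw [eB]
    rw [e1, hXU]
    simp only [Finset.mul_sum, ← Finset.sum_add_distrib]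
    exact Finset.sum_congr rfl fun b _ => Finset.sum_congr rfl fun c _ => by ring
  rw [g1, g2] at R1
  -- The identity multiplied by `u`. In `R1` the `h²` terms cancel after `H = (H/u) u`, and the `XU`
  -- terms have the common coefficient `ϕ H/u`.
  have hfin : L (B * Matrix.of fun i j => pd i (pd j (fun y => H y / u y)) p) * u p =
      Φ2 - D - H p * XΦ - (k - 1) * H p * ϕ p + (k - 1) * ϕ p * A2 * u p := by
    have hc : H p / u p * u p = H p := div_mul_cancel₀ _ hup
    generalize L (B * Matrix.of fun i j => pd i (pd j (fun y => H y / u y)) p) = Z at R1 ⊢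
    generalize H p / u p = r at R1 hc
    rw [← hc] at R1 ⊢
    linear_combination R1
  field_simp
  linear_combination hfin

end HypersurfacePatch

end

/-! ### Coordinates in which the Christoffel symbols vanish at a point. -/

section CoordinateChange

variable {n : ℕ}

/-- A polynomial change of coordinates fixing `p`, tangent to the identity there, with prescribed
second derivatives `-Γ`. -/
theorem exists_quadratic_coordinateChange (p : E n) (Γ : Fin n → Fin n → Fin n → ℝ)
    (hΓ : ∀ l i j, Γ l i j = Γ l j i) :
    ∃ ψ : E n → E n, ContDiff ℝ 4 ψ ∧ ψ p = p ∧
      (∀ i, pd i ψ p = EuclideanSpace.single i 1) ∧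
      ∀ i j l, pd i (fun y => pd j ψ y l) p = -Γ l i j := by
  let c : Fin n → E n → ℝ := fun a y => y a - p a
  let Q : Fin n → E n → ℝ := fun l y => ∑ a, ∑ b, Γ l a b * (c a y * c b y)
  -- The factor `1/2` compensates for each symmetric coefficient occurring twice in the second
  -- derivative of `Q`.
  let ψ : E n → E n := fun y => WithLp.toLp 2 fun l => y l - 1 / 2 * Q l y
  have hcs : ∀ a, ContDiff ℝ 4 (c a) := fun a =>
    (EuclideanSpace.proj a : E n →L[ℝ] ℝ).contDiff.sub contDiff_const
  have hcd : ∀ a y, DifferentiableAt ℝ (c a) y := fun a y =>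
    ((hcs a).differentiable (by norm_num)).differentiableAt
  have hc : ∀ i a y, pd i (c a) y = if a = i then 1 else 0 := by
    intro i a y
    have h1 : HasFDerivAt (c a) (EuclideanSpace.proj a : E n →L[ℝ] ℝ) y :=
      (EuclideanSpace.proj a : E n →L[ℝ] ℝ).hasFDerivAt.sub_const _
    rw [pd, h1.fderiv]
    simp
  have hQs : ∀ l, ContDiff ℝ 4 (Q l) := fun l => ContDiff.sum fun a _ => ContDiff.sum fun b _ =>
    contDiff_const.mul ((hcs a).mul (hcs b))
  have hQ : ∀ j l y, pd j (Q l) y = 2 * ∑ b, Γ l j b * c b y := by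
    intro j l y
    have d1 : ∀ a b, DifferentiableAt ℝ (fun y => c a y * c b y) y := fun a b =>
      (hcd a y).fun_mul (hcd b y)
    have d2 : ∀ a b, DifferentiableAt ℝ (fun y => Γ l a b * (c a y * c b y)) y := fun a b =>
      (differentiableAt_const _).fun_mul (d1 a b)
    change pd j (fun y => ∑ a, ∑ b, Γ l a b * (c a y * c b y)) y = _
    rw [pd_sum fun a _ => DifferentiableAt.fun_sum fun b _ => d2 a b]
    simp only [pd_sum fun b _ => d2 _ b, pd_mul (differentiableAt_const _) (d1 _ _), pd_const,
      pd_mul (hcd _ y) (hcd _ y), hc, mul_add, Finset.sum_add_distrib]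
    simp only [ite_mul, mul_ite, mul_one, one_mul, zero_mul, mul_zero, zero_add,
      Finset.sum_ite_irrel, Finset.sum_const_zero, Finset.sum_ite_eq', Finset.mem_univ, if_true,
      two_mul]
    congr 1
    exact Finset.sum_congr rfl fun a _ => by rw [hΓ]
  have hψs : ContDiff ℝ 4 ψ := by
    rw [contDiff_euclidean]
    exact fun l => (EuclideanSpace.proj l : E n →L[ℝ] ℝ).contDiff.sub (contDiff_const.mul (hQs l))
  have hψd : ∀ y, DifferentiableAt ℝ ψ y := fun y =>
    (hψs.differentiable (by norm_num)).differentiableAt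
  have hψ : ∀ j l y, pd j ψ y l = (if l = j then 1 else 0) - ∑ b, Γ l j b * c b y := by
    intro j l y
    have h1 : pd j ψ y l = pd j (fun z => ψ z l) y := by
      have h2 := ((EuclideanSpace.proj l : E n →L[ℝ] ℝ).hasFDerivAt.comp y (hψd y).hasFDerivAt)
      have h3 : (fun z => ψ z l) = (EuclideanSpace.proj l : E n →L[ℝ] ℝ) ∘ ψ := rfl
      rw [pd, pd, h3, h2.fderiv]
      rfl
    have h4 : (fun z => ψ z l) = fun z => c l z + (p l + (-(1 / 2)) * Q l z) := by
      funext z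
      change z l - 1 / 2 * Q l z = z l - p l + _
      ring
    have dQ : DifferentiableAt ℝ (Q l) y := ((hQs l).differentiable (by norm_num)).differentiableAt
    rw [h1, h4, pd_add (hcd l y) ((differentiableAt_const _).fun_add
      ((differentiableAt_const _).fun_mul dQ)), pd_add (differentiableAt_const _)
      ((differentiableAt_const _).fun_mul dQ), pd_mul (differentiableAt_const _) dQ, hQ, hc,
      pd_const, pd_const]
    ring
  refine ⟨ψ, hψs, ?_, ?_, ?_⟩
  · ext l
    simp [ψ, Q, c]
  · intro i
    ext l
    rw [hψ]
    simp [c]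
  · intro i j l
    have h1 : (fun y => pd j ψ y l) =
        fun y => (if l = j then 1 else 0) + -∑ b, Γ l j b * c b y := by
      funext y
      rw [hψ, sub_eq_add_neg]
    have d1 : ∀ b, DifferentiableAt ℝ (fun y => Γ l j b * c b y) p := fun b =>
      (differentiableAt_const _).fun_mul (hcd b p)
    rw [h1, pd_add (differentiableAt_const _) (DifferentiableAt.fun_sum fun b _ => d1 b).fun_neg,
      pd_const, pd_neg, pd_sum fun b _ => d1 b]
    simp only [pd_mul (differentiableAt_const _) (hcd _ p), pd_const, hc]
    simp [hΓ l i j]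

variable {V : Type*} [NormedAddCommGroup V] [NormedSpace ℝ V] {ψ : E n → E n} {p : E n}

theorem pd_comp {f : E n → V} {y : E n} (hf : DifferentiableAt ℝ f (ψ y))
    (hψ : DifferentiableAt ℝ ψ y) (j : Fin n) :
    pd j (fun z => f (ψ z)) y = ∑ a, pd j ψ y a • pd a f (ψ y) := by
  have h := (hf.hasFDerivAt.comp y hψ.hasFDerivAt).fderiv
  change fderiv ℝ (f ∘ ψ) y _ = _
  rw [h, ContinuousLinearMap.comp_apply]
  exact map_euclidean_eq_sum _ _

theorem pd_comp_of_tangent {f : E n → V} (hf : DifferentiableAt ℝ f p)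
    (hψ : DifferentiableAt ℝ ψ p) (hp : ψ p = p)
    (h1 : ∀ i, pd i ψ p = EuclideanSpace.single i 1) (j : Fin n) :
    pd j (fun z => f (ψ z)) p = pd j f p := by
  rw [pd_comp (by rwa [hp]) hψ, h1, hp]
  simp

theorem contDiffAt_pd_apply {m : ℕ∞ω} (hψ : ContDiffAt ℝ (m + 1) ψ p) (j l : Fin n) :
    ContDiffAt ℝ m (fun y => pd j ψ y l) p :=
  (contDiffAt_euclidean.1 (contDiffAt_pd hψ le_rfl j)) l

/-- In the new coordinates the covariant Hessian at `p` is the coordinate Hessian. -/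
theorem pd_pd_comp_eq_covHess {g : E n → Matrix (Fin n) (Fin n) ℝ} (hψ : ContDiff ℝ 4 ψ)
    (hp : ψ p = p) (h1 : ∀ i, pd i ψ p = EuclideanSpace.single i 1)
    (h2 : ∀ i j l, pd i (fun y => pd j ψ y l) p = -christoffel g l i j p)
    {f : E n → ℝ} (hf : ContDiffAt ℝ 2 f p) (i j : Fin n) :
    pd i (pd j (fun z => f (ψ z))) p = covHess g f i j p := by
  have hψd : ∀ y, DifferentiableAt ℝ ψ y := fun y =>
    (hψ.differentiable (by norm_num)).differentiableAt
  have hev : pd j (fun z => f (ψ z)) =ᶠ[𝓝 p] fun y => ∑ a, pd j ψ y a * pd a f (ψ y) := by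
    have hf' : ∀ᶠ y in 𝓝 (ψ p), DifferentiableAt ℝ f y := by
      rw [hp]; exact eventually_differentiableAt hf (by norm_num)
    filter_upwards [hψ.continuous.continuousAt.eventually hf'] with y hy
    exact pd_comp hy (hψd y) j
  have d1 : ∀ a, DifferentiableAt ℝ (fun y => pd j ψ y a) p := fun a =>
    (contDiffAt_pd_apply (m := 3) (hψ.contDiffAt.of_le (by norm_num)) j a).differentiableAt
      (by norm_num)
  have d2 : ∀ a, DifferentiableAt ℝ (pd a f) p := fun a =>
    (contDiffAt_pd (m := 1) hf (by norm_num) a).differentiableAt (by norm_num)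
  have d3 : ∀ a, DifferentiableAt ℝ (fun y => pd a f (ψ y)) p := fun a =>
    DifferentiableAt.comp (g := pd a f) p (by rw [hp]; exact d2 a) (hψd p)
  rw [(pd_congr hev i).self_of_nhds, pd_sum fun a _ => (d1 a).fun_mul (d3 a), covHess]
  simp only [pd_mul (d1 _) (d3 _), h2, h1, hp, pd_comp_of_tangent (d2 _) (hψd p) hp h1,
    Finset.sum_add_distrib]
  simp
  ring

/-- In the new coordinates the covariant derivative at `p` is the coordinate derivative. -/
theorem pd_congruence_eq_covDeriv {g T : E n → Matrix (Fin n) (Fin n) ℝ} (hψ : ContDiff ℝ 4 ψ)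
    (hp : ψ p = p) (h1 : ∀ i, pd i ψ p = EuclideanSpace.single i 1)
    (h2 : ∀ i j l, pd i (fun y => pd j ψ y l) p = -christoffel g l i j p)
    (hT : ∀ i j, DifferentiableAt ℝ (fun y => T y i j) p) (i j s : Fin n) :
    pd s (fun y => ((matrixOf (fderiv ℝ ψ y)).transpose * T (ψ y) *
      matrixOf (fderiv ℝ ψ y)) i j) p = covDeriv g T i j s p := by
  have hψd : ∀ y, DifferentiableAt ℝ ψ y := fun y =>
    (hψ.differentiable (by norm_num)).differentiableAt
  have e1 : (fun y => ((matrixOf (fderiv ℝ ψ y)).transpose * T (ψ y) *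
      matrixOf (fderiv ℝ ψ y)) i j) =
      fun y => ∑ b, (∑ a, pd i ψ y a * T (ψ y) a b) * pd j ψ y b := by
    funext y
    rw [Matrix.mul_apply]
    refine Finset.sum_congr rfl fun b _ => ?_
    rw [Matrix.mul_apply]
    rfl
  have d1 : ∀ k a, DifferentiableAt ℝ (fun y => pd k ψ y a) p := fun k a =>
    (contDiffAt_pd_apply (m := 3) (hψ.contDiffAt.of_le (by norm_num)) k a).differentiableAt
      (by norm_num)
  have d3 : ∀ a b, DifferentiableAt ℝ (fun y => T (ψ y) a b) p := fun a b =>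
    DifferentiableAt.comp (g := fun y => T y a b) p (by rw [hp]; exact hT a b) (hψd p)
  have d4 : ∀ a b, DifferentiableAt ℝ (fun y => pd i ψ y a * T (ψ y) a b) p := fun a b =>
    (d1 i a).fun_mul (d3 a b)
  have d5 : ∀ b, DifferentiableAt ℝ (fun y => ∑ a, pd i ψ y a * T (ψ y) a b) p := fun b =>
    DifferentiableAt.fun_sum fun a _ => d4 a b
  have e2 : ∀ a b, pd s (fun y => T (ψ y) a b) p = pd s (fun y => T y a b) p := fun a b =>
    pd_comp_of_tangent (f := fun y => T y a b) (hT a b) (hψd p) hp h1 s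
  rw [e1, pd_sum fun b _ => (d5 b).fun_mul (d1 j b)]
  simp only [pd_mul (d5 _) (d1 j _), pd_sum fun a _ => d4 a _, pd_mul (d1 i _) (d3 _ _), e2, h1, h2,
    hp, covDeriv]
  simp [Finset.sum_add_distrib, mul_comm]
  ring

theorem christoffel_symm {g : E n → Matrix (Fin n) (Fin n) ℝ} (hg : ∀ y, (g y).transpose = g y)
    (l i j : Fin n) (y : E n) : christoffel g l i j y = christoffel g l j i y := by
  have h : ∀ a b, (fun z => g z a b) = fun z => g z b a := fun a b => by
    funext z
    exact congrFun (congrFun (hg z) b) a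
  simp only [christoffel]
  congr 1
  refine Finset.sum_congr rfl fun m _ => ?_
  rw [h i j]; ring

/-- The Levi-Civita connection is compatible with the metric. -/
theorem covDeriv_self {g : E n → Matrix (Fin n) (Fin n) ℝ} (hg : ∀ y, (g y).transpose = g y)
    {y : E n} (hy : IsUnit (g y).det) (i j s : Fin n) : covDeriv g g i j s y = 0 := by
  have h : ∀ a b, (fun z => g z a b) = fun z => g z b a := fun a b => by
    funext z
    exact congrFun (congrFun (hg z) b) a
  -- Lowering the index gives Christoffel symbols of the first kind; the two that occur in `∇g` add
  -- up to `∂_s g_ij`.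
  have hlow : ∀ s i j, ∑ l, christoffel g l s i y * g y l j = (1 / 2) *
      (pd s (fun z => g z i j) y + pd i (fun z => g z s j) y - pd j (fun z => g z s i) y) := by
    intro s i j
    have e1 : ∀ m, ∑ l, g y j l * (g y)⁻¹ l m = (1 : Matrix (Fin n) (Fin n) ℝ) j m := fun m => by
      rw [← Matrix.mul_apply, Matrix.mul_nonsing_inv _ hy]
    have e2 : ∑ l, christoffel g l s i y * g y l j = (1 / 2) * ∑ m, (∑ l, g y j l * (g y)⁻¹ l m) *
        (pd s (fun z => g z i m) y + pd i (fun z => g z s m) y - pd m (fun z => g z s i) y) := by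
      simp only [christoffel, Finset.mul_sum, Finset.sum_mul]
      rw [Finset.sum_comm]
      refine Finset.sum_congr rfl fun m _ => Finset.sum_congr rfl fun l _ => ?_
      rw [show g y l j = g y j l from congrFun (h l j) y]; ring
    rw [e2]
    simp [e1, Matrix.one_apply]
  have h3 : ∑ l, christoffel g l s j y * g y i l = ∑ l, christoffel g l s j y * g y l i :=
    Finset.sum_congr rfl fun l _ => by rw [show g y l i = g y i l from congrFun (h l i) y]
  rw [covDeriv, h3, hlow, hlow, h j i]
  ring

end CoordinateChange

/-! ### Transfer of the identity to arbitrary coordinates. -/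

namespace HypersurfacePatch

variable {n : ℕ} {Y N : E n → E (n + 1)} {p : E n} {ψ : E n → E n}

theorem eventually_gram_comp {A B : E n → E (n + 1)} (hA : ContDiffAt ℝ 1 A p)
    (hB : ContDiffAt ℝ 1 B p) (hψ : ContDiff ℝ 4 ψ) (hp : ψ p = p) :
    ∀ᶠ y in 𝓝 p, gram (fderiv ℝ (fun z => A (ψ z)) y) (fderiv ℝ (fun z => B (ψ z)) y) =
      (matrixOf (fderiv ℝ ψ y)).transpose * gram (fderiv ℝ A (ψ y)) (fderiv ℝ B (ψ y)) *
        matrixOf (fderiv ℝ ψ y) := by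
  have hψd : ∀ y, DifferentiableAt ℝ ψ y := fun y =>
    (hψ.differentiable (by norm_num)).differentiableAt
  have hA' : ∀ᶠ y in 𝓝 (ψ p), DifferentiableAt ℝ A y := by
    rw [hp]; exact eventually_differentiableAt hA le_rfl
  have hB' : ∀ᶠ y in 𝓝 (ψ p), DifferentiableAt ℝ B y := by
    rw [hp]; exact eventually_differentiableAt hB le_rfl
  filter_upwards [hψ.continuous.continuousAt.eventually hA',
    hψ.continuous.continuousAt.eventually hB'] with y hy hy'
  rw [← gram_comp]
  congr 1
  · exact (hy.hasFDerivAt.comp y (hψd y).hasFDerivAt).fderiv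
  · exact (hy'.hasFDerivAt.comp y (hψd y).hasFDerivAt).fderiv

theorem fderiv_eq_id_of_pd (h1 : ∀ i, pd i ψ p = EuclideanSpace.single i 1) :
    fderiv ℝ ψ p = ContinuousLinearMap.id ℝ (E n) := by
  ext1 v
  rw [map_euclidean_eq_sum]
  conv_rhs => rw [ContinuousLinearMap.id_apply, euclidean_eq_sum_single v]
  exact Finset.sum_congr rfl fun i _ => congrArg (v i • ·) (h1 i)

theorem comp (P : HypersurfacePatch Y N p) (hψ : ContDiff ℝ 4 ψ) (hp : ψ p = p)
    (h1 : ∀ i, pd i ψ p = EuclideanSpace.single i 1) :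
    HypersurfacePatch (fun y => Y (ψ y)) (fun y => N (ψ y)) p := by
  have hψd : ∀ y, DifferentiableAt ℝ ψ y := fun y =>
    (hψ.differentiable (by norm_num)).differentiableAt
  have hcont : Tendsto ψ (𝓝 p) (𝓝 p) := by
    have := hψ.continuous.continuousAt (x := p)
    rwa [ContinuousAt, hp] at this
  have hd := eventually_differentiableAt P.contDiffAt_param (by norm_num)
  have hfd : ∀ y, DifferentiableAt ℝ Y (ψ y) →
      fderiv ℝ (fun z => Y (ψ z)) y = (fderiv ℝ Y (ψ y)).comp (fderiv ℝ ψ y) := fun y hy =>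
    (hy.hasFDerivAt.comp y (hψd y).hasFDerivAt).fderiv
  refine ⟨?_, ?_, ?_, hcont.eventually P.norm_normal, ?_⟩
  · exact ContDiffAt.comp p (by rw [hp]; exact P.contDiffAt_param) hψ.contDiffAt
  · exact ContDiffAt.comp p (by rw [hp]; exact P.contDiffAt_normal)
      (hψ.contDiffAt.of_le (by norm_num))
  · rw [hfd p (by rw [hp]; exact hd.self_of_nhds), hp, fderiv_eq_id_of_pd h1,
      ContinuousLinearMap.comp_id]
    exact P.injective_fderiv
  · filter_upwards [hcont.eventually P.inner_fderiv_normal, hcont.eventually hd] with y hy hy' v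
    rw [hfd y hy']
    exact hy _

/-- The identity at a local maximum of `H / u`, in arbitrary coordinates. -/
theorem covHess_meanCurvature_div_support (P : HypersurfacePatch Y N p) {k : ℕ} (hn : 1 ≤ n)
    (hk : k ≤ n) {u H ϕ : E n → ℝ} (hu : u = fun y => ⟪Y y, N y⟫) (hup : u p ≠ 0)
    (hH : H =ᶠ[𝓝 p] fun y => sigmaForm 1 (metric Y y) (secondForm Y N y))
    (hF : (fun y => sigmaForm k (metric Y y) (secondForm Y N y)) =ᶠ[𝓝 p] fun y => ϕ y * u y)
    (hmax : IsLocalMax (fun y => H y / u y) p) :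
    ∑ i, ∑ j, dF k (metric Y p) (secondForm Y N p) i j *
        covHess (metric Y) (fun y => H y / u y) i j p
      = (1 / u p) * (∑ s, ∑ t, (metric Y p)⁻¹ s t *
            (covHess (metric Y) ϕ s t p * u p + 2 * pd s ϕ p * pd t u p))
        - (H p / u p) * (∑ l, ∑ m, (metric Y p)⁻¹ l m * (pd l ϕ p * ⟪Y p, pd m Y p⟫))
        - ((k : ℝ) - 1) * (H p / u p) * ϕ p
        + ((k : ℝ) - 1) * ϕ p *
            (∑ i, ∑ j, ∑ a, ∑ b, (metric Y p)⁻¹ i a * (metric Y p)⁻¹ j b *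
              (secondForm Y N p i j * secondForm Y N p a b))
        - (1 / u p) * (∑ s, ∑ t, (metric Y p)⁻¹ s t * ∑ i, ∑ j, ∑ m, ∑ l,
            ddF k (metric Y p) (secondForm Y N p) i j m l *
              covDeriv (metric Y) (secondForm Y N) i j s p *
              covDeriv (metric Y) (secondForm Y N) m l t p) := by
  have hgt : ∀ y, (metric Y y).transpose = metric Y y := fun y => gram_transpose _
  obtain ⟨ψ, hψ, hp, h1, h2⟩ := exists_quadratic_coordinateChange p
    (fun l i j => christoffel (metric Y) l i j p) (fun l i j => christoffel_symm hgt l i j p)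
  have hψd : ∀ y, DifferentiableAt ℝ ψ y := fun y =>
    (hψ.differentiable (by norm_num)).differentiableAt
  have hcont : Tendsto ψ (𝓝 p) (𝓝 p) := by
    have := hψ.continuous.continuousAt (x := p)
    rwa [ContinuousAt, hp] at this
  have hid : matrixOf (fderiv ℝ ψ p) = 1 := by
    rw [fderiv_eq_id_of_pd h1]
    ext i j
    simp [matrixOf, Matrix.one_apply]
  have P' := P.comp hψ hp h1
  have cY : ContDiffAt ℝ 1 Y p := P.contDiffAt_param.of_le (by norm_num)
  have cN : ContDiffAt ℝ 1 N p := P.contDiffAt_normal.of_le (by norm_num)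
  have emet : ∀ᶠ y in 𝓝 p, metric (fun y => Y (ψ y)) y = (matrixOf (fderiv ℝ ψ y)).transpose *
      metric Y (ψ y) * matrixOf (fderiv ℝ ψ y) := eventually_gram_comp cY cY hψ hp
  have esec : ∀ᶠ y in 𝓝 p, secondForm (fun y => Y (ψ y)) (fun y => N (ψ y)) y =
      (matrixOf (fderiv ℝ ψ y)).transpose * secondForm Y N (ψ y) * matrixOf (fderiv ℝ ψ y) :=
    eventually_gram_comp cY cN hψ hp
  have hJ : ∀ᶠ y in 𝓝 p, IsUnit (matrixOf (fderiv ℝ ψ y)).det := by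
    have hc : ContinuousAt (fun y => (matrixOf (fderiv ℝ ψ y)).det) p :=
      (contDiffAt_det (m := 3) (G := fun y => matrixOf (fderiv ℝ ψ y)) fun i j =>
        contDiffAt_pd_apply (hψ.contDiffAt.of_le (by norm_num)) j i).continuousAt
    have h0 : (matrixOf (fderiv ℝ ψ p)).det ≠ 0 := by rw [hid, Matrix.det_one]; exact one_ne_zero
    filter_upwards [hc.eventually_ne h0] with y hy
    exact isUnit_iff_ne_zero.2 hy
  -- Equality near `p`, not just at `p`, is needed since `H` and `F` are differentiated twice.
  have esig : ∀ m, ∀ᶠ y in 𝓝 p, sigmaForm m (metric (fun y => Y (ψ y)) y)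
      (secondForm (fun y => Y (ψ y)) (fun y => N (ψ y)) y) =
      sigmaForm m (metric Y (ψ y)) (secondForm Y N (ψ y)) := by
    intro m
    filter_upwards [emet, esec, hJ] with y e1 e2 e3
    rw [e1, e2, sigmaForm_congruence m _ _ e3]
  have emp : metric (fun y => Y (ψ y)) p = metric Y p := by
    rw [emet.self_of_nhds, hid, hp, Matrix.transpose_one, one_mul, mul_one]
  have esp : secondForm (fun y => Y (ψ y)) (fun y => N (ψ y)) p = secondForm Y N p := by
    rw [esec.self_of_nhds, hid, hp, Matrix.transpose_one, one_mul, mul_one]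
  -- At `p` the new `∂g` is the old `∇g`, which is zero by metric compatibility.
  have hcovg : ∀ s i j, pd s (fun y => metric (fun y => Y (ψ y)) y i j) p = 0 := by
    intro s i j
    have e1 : (fun y => metric (fun y => Y (ψ y)) y i j) =ᶠ[𝓝 p]
        fun y => ((matrixOf (fderiv ℝ ψ y)).transpose * metric Y (ψ y) *
          matrixOf (fderiv ℝ ψ y)) i j := by
      filter_upwards [emet] with y hy
      rw [hy]
    rw [(pd_congr e1 s).self_of_nhds, pd_congruence_eq_covDeriv hψ hp h1 h2
      (fun a b => (P.contDiffAt_metric a b).differentiableAt (by norm_num)),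
      covDeriv_self hgt P.isUnit_det_metric]
  have hcovh : ∀ s i j, pd s (fun y =>
      secondForm (fun y => Y (ψ y)) (fun y => N (ψ y)) y i j) p =
      covDeriv (metric Y) (secondForm Y N) i j s p := by
    intro s i j
    have e1 : (fun y => secondForm (fun y => Y (ψ y)) (fun y => N (ψ y)) y i j) =ᶠ[𝓝 p]
        fun y => ((matrixOf (fderiv ℝ ψ y)).transpose * secondForm Y N (ψ y) *
          matrixOf (fderiv ℝ ψ y)) i j := by
      filter_upwards [esec] with y hy
      rw [hy]
    rw [(pd_congr e1 s).self_of_nhds, pd_congruence_eq_covDeriv hψ hp h1 h2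
      (fun a b => (P.contDiffAt_secondForm a b).differentiableAt (by norm_num))]
  have hu2 : ContDiffAt ℝ 2 u p := by
    rw [hu]; exact P.contDiffAt_support.of_le (by norm_num)
  have hQ2 : ContDiffAt ℝ 2 (fun y => H y / u y) p :=
    ((P.contDiffAt_sigmaForm 1).congr_of_eventuallyEq hH).div hu2 hup
  have hϕ2 : ContDiffAt ℝ 2 ϕ p := by
    refine ((P.contDiffAt_sigmaForm k).div hu2 hup).congr_of_eventuallyEq ?_
    filter_upwards [hF, hu2.continuousAt.eventually_ne hup] with y e1 e2
    rw [Pi.div_apply, e1, mul_div_cancel_right₀ _ e2]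
  have hmain := P'.hess_meanCurvature_div_support hcovg hn hk
    (u := fun y => u (ψ y)) (H := fun y => H (ψ y)) (ϕ := fun y => ϕ (ψ y))
    (by funext y; rw [hu]) (by rwa [hp])
    (by
      filter_upwards [hcont.eventually hH, esig 1] with y e1 e2
      rw [e1, e2])
    (by
      filter_upwards [hcont.eventually hF, esig k] with y e1 e2
      rw [e2, e1])
    (by
      intro i
      have e1 : pd i (fun y => H (ψ y) / u (ψ y)) p = pd i (fun y => H y / u y) p :=
        pd_comp_of_tangent (f := fun y => H y / u y) (hQ2.differentiableAt (by norm_num)) (hψd p)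
          hp h1 i
      -- The only use of maximality.
      rw [e1, pd, hmax.fderiv_eq_zero]
      rfl)
  have t1 : ∀ i j, pd i (pd j (fun y => H (ψ y) / u (ψ y))) p =
      covHess (metric Y) (fun y => H y / u y) i j p := fun i j =>
    pd_pd_comp_eq_covHess (f := fun y => H y / u y) hψ hp h1 h2 hQ2 i j
  have t2 : ∀ i j, pd i (pd j (fun y => ϕ (ψ y))) p = covHess (metric Y) ϕ i j p := fun i j =>
    pd_pd_comp_eq_covHess hψ hp h1 h2 hϕ2 i j
  have t3 : ∀ i, pd i (fun y => ϕ (ψ y)) p = pd i ϕ p := fun i =>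
    pd_comp_of_tangent (hϕ2.differentiableAt (by norm_num)) (hψd p) hp h1 i
  have t4 : ∀ i, pd i (fun y => u (ψ y)) p = pd i u p := fun i =>
    pd_comp_of_tangent (hu2.differentiableAt (by norm_num)) (hψd p) hp h1 i
  have t5 : ∀ i, pd i (fun y => Y (ψ y)) p = pd i Y p := fun i =>
    pd_comp_of_tangent (cY.differentiableAt (by norm_num)) (hψd p) hp h1 i
  simp only [t1, t2, t3, t4, t5, hp, emp, esp, hcovh] at hmain
  exact hmain

end HypersurfacePatch

/-! ### Regularity of the normal field, and passage from the manifold to a chart. -/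

section

variable {n : ℕ}

/-- The unit normal field on the same side as the position vector is of class `C^3`. -/
theorem contDiffAt_normal_of_support_pos {Y N : E n → E (n + 1)} {p : E n}
    (hY : ContDiffAt ℝ 4 Y p) (hinj : ∀ᶠ y in 𝓝 p, Function.Injective (fderiv ℝ Y y))
    (hN : ∀ᶠ y in 𝓝 p, ‖N y‖ = 1) (hperp : ∀ᶠ y in 𝓝 p, ∀ v, ⟪fderiv ℝ Y y v, N y⟫ = 0)
    (hu : ∀ᶠ y in 𝓝 p, 0 < ⟪Y y, N y⟫) : ContDiffAt ℝ 3 N p := by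
  have hpd : ∀ i, ContDiffAt ℝ 3 (pd i Y) p := fun i => contDiffAt_pd hY (by norm_num) i
  have hY3 : ContDiffAt ℝ 3 Y p := hY.of_le (by norm_num)
  have hB : ∀ a b, ContDiffAt ℝ 3 (fun y => (metric Y y)⁻¹ a b) p :=
    contDiffAt_inv_apply (fun i j => (hpd i).inner ℝ (hpd j))
      (isUnit_det_gram hinj.self_of_nhds)
  -- `W` is the normal part of `Y`, which is `u N`; as `u > 0`, its norm is `u` and normalizing
  -- recovers `N` with the right sign.
  let W : E n → E (n + 1) := fun y =>
    Y y - ∑ a, ∑ b, ((metric Y y)⁻¹ a b * ⟪Y y, pd b Y y⟫) • pd a Y y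
  have hW : ContDiffAt ℝ 3 W p := hY3.sub (ContDiffAt.sum fun a _ => ContDiffAt.sum fun b _ =>
    ((hB a b).mul (hY3.inner ℝ (hpd b))).smul (hpd a))
  have hWN : ∀ᶠ y in 𝓝 p, W y = ⟪Y y, N y⟫ • N y := by
    filter_upwards [hinj, hN, hperp] with y h1 h2 h3
    have h4 := eq_tangential_add_normal h1 h2 h3 (Y y)
    exact sub_eq_of_eq_add' h4
  have hnorm : ∀ᶠ y in 𝓝 p, ‖W y‖ = ⟪Y y, N y⟫ := by
    filter_upwards [hWN, hN, hu] with y h1 h2 h3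
    rw [h1, norm_smul, h2, mul_one, Real.norm_of_nonneg h3.le]
  have hWp : W p ≠ 0 := by
    rw [← norm_ne_zero_iff, hnorm.self_of_nhds]
    exact ne_of_gt hu.self_of_nhds
  have hfin : ContDiffAt ℝ 3 (fun y => ‖W y‖⁻¹ • W y) p :=
    ((hW.norm ℝ hWp).inv (norm_ne_zero_iff.2 hWp)).smul hW
  refine hfin.congr_of_eventuallyEq ?_
  filter_upwards [hWN, hnorm, hu] with y h1 h2 h3
  rw [h2, h1, smul_smul, inv_mul_cancel₀ (ne_of_gt h3), one_smul]

section Manifold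

variable {M : Type*} [TopologicalSpace M] [ChartedSpace (E n) M]

/-- `diffAt` is computed in the preferred chart at the point, whereas `e` is arbitrary. `J`, the
differential of `e.symm`, mediates between them, is invertible, and serves all `f` at once. -/
theorem exists_fderiv_comp_symm {e : OpenPartialHomeomorph M (E n)}
    (he : e ∈ IsManifold.maximalAtlas (𝓡 n) 4 M) {y : E n} (hy : y ∈ e.target) :
    ∃ J : E n →L[ℝ] E n, IsUnit (matrixOf J).det ∧ ∀ f : M → E (n + 1),
      MDifferentiableAt (𝓡 n) 𝓘(ℝ, E (n + 1)) f (e.symm y) →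
        fderiv ℝ (fun z => f (e.symm z)) y = (diffAt f (e.symm y)).comp J := by
  have hs : MDifferentiableAt (𝓡 n) (𝓡 n) e.symm y :=
    (contMDiffAt_symm_of_mem_maximalAtlas he hy).mdifferentiableAt (by norm_num)
  have hd : MDifferentiableAt (𝓡 n) (𝓡 n) e (e.symm y) :=
    (contMDiffAt_of_mem_maximalAtlas he (e.map_target hy)).mdifferentiableAt (by norm_num)
  have hcomp := mfderiv_comp y hd hs
  have hid : e ∘ e.symm =ᶠ[𝓝 y] id := by
    filter_upwards [e.open_target.mem_nhds hy] with z hz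
    exact e.right_inv hz
  rw [hid.mfderiv_eq, mfderiv_id] at hcomp
  refine ⟨mfderiv (𝓡 n) (𝓡 n) e.symm y, isUnit_det_matrixOf hcomp.symm, fun f hf => ?_⟩
  have h := mfderiv_comp y hf hs
  rw [mfderiv_eq_fderiv] at h
  exact h

theorem mdifferentiableAt_of_comp_symm {e : OpenPartialHomeomorph M (E n)}
    (he : e ∈ IsManifold.maximalAtlas (𝓡 n) 4 M) {y : E n} (hy : y ∈ e.target)
    {f : M → E (n + 1)} (hf : DifferentiableAt ℝ (fun z => f (e.symm z)) y) :
    MDifferentiableAt (𝓡 n) 𝓘(ℝ, E (n + 1)) f (e.symm y) := by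
  have hd : MDifferentiableAt (𝓡 n) (𝓡 n) e (e.symm y) :=
    (contMDiffAt_of_mem_maximalAtlas he (e.map_target hy)).mdifferentiableAt (by norm_num)
  have hf' : MDifferentiableAt (𝓡 n) 𝓘(ℝ, E (n + 1)) (fun z => f (e.symm z)) (e (e.symm y)) := by
    rw [e.right_inv hy]
    exact hf.mdifferentiableAt
  refine (hf'.comp (e.symm y) hd).congr_of_eventuallyEq ?_
  filter_upwards [e.open_source.mem_nhds (e.map_target hy)] with x hx
  rw [Function.comp_apply, e.left_inv hx]

theorem hypersurfacePatch_of_chart [IsManifold (𝓡 n) 4 M] {X ν : M → E (n + 1)}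
    (hX : ContMDiff (𝓡 n) 𝓘(ℝ, E (n + 1)) 4 X) (hXinj : ∀ x, Function.Injective (diffAt X x))
    (hνnorm : ∀ x, ‖ν x‖ = 1) (hνperp : ∀ x v, ⟪diffAt X x v, ν x⟫ = 0)
    (hu : ∀ x, 0 < supportFn X ν x) {e : OpenPartialHomeomorph M (E n)}
    (he : e ∈ IsManifold.maximalAtlas (𝓡 n) 4 M) {p : E n} (hp : p ∈ e.target) :
    HypersurfacePatch (fun y => X (e.symm y)) (fun y => ν (e.symm y)) p := by
  have htgt : ∀ᶠ y in 𝓝 p, y ∈ e.target := e.open_target.mem_nhds hp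
  have hY : ContDiffAt ℝ 4 (fun y => X (e.symm y)) p :=
    ((hX _).comp p (contMDiffAt_symm_of_mem_maximalAtlas he hp)).contDiffAt
  have hXd : ∀ x, MDifferentiableAt (𝓡 n) 𝓘(ℝ, E (n + 1)) X x := fun x =>
    (hX x).mdifferentiableAt (by norm_num)
  have hinj : ∀ y ∈ e.target, Function.Injective (fderiv ℝ (fun y => X (e.symm y)) y) := by
    intro y hy
    obtain ⟨J, hJ, hf⟩ := exists_fderiv_comp_symm he hy
    rw [hf X (hXd _)]
    refine (hXinj _).comp ?_
    intro v w hvw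
    have h1 : ∀ v : E n, (J v).ofLp = (matrixOf J).mulVec v.ofLp := by
      intro v
      ext i
      rw [map_euclidean_eq_sum J v]
      simp [matrixOf, Matrix.mulVec, dotProduct, mul_comm]
    have h2 : (matrixOf J).mulVec v.ofLp = (matrixOf J).mulVec w.ofLp := by
      rw [← h1, ← h1, show J v = J w from hvw]
    exact WithLp.ofLp_injective 2
      (Matrix.mulVec_injective_of_isUnit ((Matrix.isUnit_iff_isUnit_det _).2 hJ) h2)
  have hperp : ∀ y ∈ e.target, ∀ v, ⟪fderiv ℝ (fun y => X (e.symm y)) y v, ν (e.symm y)⟫ = 0 := by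
    intro y hy v
    obtain ⟨J, -, hf⟩ := exists_fderiv_comp_symm he hy
    rw [hf X (hXd _)]
    exact hνperp _ _
  exact ⟨hY, contDiffAt_normal_of_support_pos hY (htgt.mono hinj)
    (Eventually.of_forall fun y => hνnorm _) (htgt.mono hperp)
    (Eventually.of_forall fun y => hu _), hinj p hp, Eventually.of_forall fun y => hνnorm _,
    htgt.mono hperp⟩

/-- The curvature functions can be computed in any chart. -/
theorem sigmaCurv_symm_eq [IsManifold (𝓡 n) 4 M] {X ν : M → E (n + 1)}
    (hX : ContMDiff (𝓡 n) 𝓘(ℝ, E (n + 1)) 4 X) {e : OpenPartialHomeomorph M (E n)}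
    (he : e ∈ IsManifold.maximalAtlas (𝓡 n) 4 M) {y : E n} (hy : y ∈ e.target)
    (hν : DifferentiableAt ℝ (fun z => ν (e.symm z)) y) (k : ℕ) :
    sigmaCurv k X ν (e.symm y) =
      sigmaForm k (metric (fun z => X (e.symm z)) y)
        (secondForm (fun z => X (e.symm z)) (fun z => ν (e.symm z)) y) := by
  obtain ⟨J, hJ, hf⟩ := exists_fderiv_comp_symm he hy
  rw [metric, secondForm, hf X ((hX _).mdifferentiableAt (by norm_num)),
    hf ν (mdifferentiableAt_of_comp_symm he hy hν), gram_comp, gram_comp,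
    sigmaForm_congruence k _ _ hJ, sigmaCurv]

end Manifold

end

end PrescribedCurvature

end

/-! ### The theorem in an arbitrary chart. -/

open PrescribedCurvature
theorem proposition3p1 {n k : ℕ} (hk : 1 < k) (hkn : k < n)
    {M : Type*} [TopologicalSpace M] [ChartedSpace (E n) M]
    [IsManifold (𝓡 n) 4 M]
    (X ν : M → E (n + 1))
    (hX : ContMDiff (𝓡 n) 𝓘(ℝ, E (n + 1)) 4 X)
    (hXinj : ∀ x, Function.Injective (diffAt X x))
    (hνnorm : ∀ x, ‖ν x‖ = 1)
    (hνperp : ∀ x v, ⟪diffAt X x v, ν x⟫ = 0)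
    (hu : ∀ x, 0 < supportFn X ν x)
    (φ : M → ℝ)
    (hF : ∀ x, sigmaCurv k X ν x = φ x * supportFn X ν x)
    (P : M)
    (hP : IsLocalMax
      (fun x => sigmaCurv 1 X ν x / supportFn X ν x) P)
    (e : OpenPartialHomeomorph M (E n))
    (he : e ∈ IsManifold.maximalAtlas (𝓡 n) 4 M) (hPe : P ∈ e.source) :
    -- local expressions, in the arbitrary chart `e` around `P`
    let p := e P
    let Y : E n → E (n + 1) := fun y => X (e.symm y)
    let N : E n → E (n + 1) := fun y => ν (e.symm y)
    let u : E n → ℝ := fun y => supportFn X ν (e.symm y)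
    let H : E n → ℝ := fun y => sigmaCurv 1 X ν (e.symm y)
    let ϕ : E n → ℝ := fun y => φ (e.symm y)
    let g := metric Y
    let h := secondForm Y N
    let gi : Matrix (Fin n) (Fin n) ℝ := (g p)⁻¹
    ∑ i, ∑ j, dF k (g p) (h p) i j *
        covHess g (fun y => H y / u y) i j p
      = (1 / u p) * (∑ s, ∑ t, gi s t *
            (covHess g ϕ s t p * u p
              + 2 * pd s ϕ p * pd t u p))
        - (H p / u p) * (∑ l, ∑ m, gi l m *
            (pd l ϕ p * ⟪Y p, pd m Y p⟫))
        - ((k : ℝ) - 1) * (H p / u p) * ϕ p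
        + ((k : ℝ) - 1) * ϕ p *
            (∑ i, ∑ j, ∑ a, ∑ b, gi i a * gi j b * (h p i j * h p a b))
        - (1 / u p) * (∑ s, ∑ t, gi s t * ∑ i, ∑ j, ∑ m, ∑ l,
            ddF k (g p) (h p) i j m l *
              covDeriv g h i j s p *
              covDeriv g h m l t p) := by
  intro p Y N u H ϕ g h gi
  have hpt : p ∈ e.target := e.map_source hPe
  have hpatch : ∀ y ∈ e.target, HypersurfacePatch Y N y := fun y hy =>
    hypersurfacePatch_of_chart hX hXinj hνnorm hνperp hu he hy
  have htgt : ∀ᶠ y in nhds p, y ∈ e.target := e.open_target.mem_nhds hpt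
  -- The `C^3` regularity of `N` obtained from the patch is what makes `diffAt ν` a genuine
  -- derivative here.
  have hsig : ∀ m, ∀ᶠ y in nhds p,
      sigmaCurv m X ν (e.symm y) = sigmaForm m (metric Y y) (secondForm Y N y) := fun m =>
    htgt.mono fun y hy => sigmaCurv_symm_eq hX he hy
      ((hpatch y hy).contDiffAt_normal.differentiableAt (by norm_num)) m
  have hmax : IsLocalMax (fun y => H y / u y) p := by
    have hP' : IsLocalMax (fun x => sigmaCurv 1 X ν x / supportFn X ν x) (e.symm p) := by
      rwa [e.left_inv hPe]
    exact hP'.comp_continuous (e.continuousAt_symm hpt)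
  refine (hpatch p hpt).covHess_meanCurvature_div_support (k := k) (by omega) hkn.le
    (u := u) (H := H) (ϕ := ϕ) rfl (hu _).ne' (hsig 1) ?_ hmax
  exact (hsig k).mono fun y hy => hy.symm.trans (hF _)
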